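/- For a prime $p$ let $p^{+}$ be the least prime greater than $p$, let $p^{+(j)}$ be the $j$-th successor prime ($p^{+(0)}=p$), and let $g(p)=p^{+}-p$. For an integer $t\ge 1$ put $$\mathbf G^{(t)}(p)=\bigl(g(p),g(p^{+}),\dots,g(p^{+(t-1)})\bigr),$$ and for real $X$ let $\mu_X^{(t)}$ be the law of $\mathbf G^{(t)}(P)$, where $P$ is uniformly distributed on the primes in $[X,2X]$. For $\mathbf g=(g_1,\dots,g_t)$, a vector of nonnegative integers, put $H_0=0$ and $H_k=g_1+\cdots+g_k$, and let $$\mathfrak S(0,H_1,\dots,H_t)=\prod_{q\ \mathrm{prime}}\Bigl(1-\frac{\nu(q)}{q}\Bigr)\Bigl(1-\frac1q\Bigr)^{-|\mathcal H|}$$ be the Hardy–Littlewood singular series of the set $\mathcal H=\{0,H_1,\dots,H_t\}$, where $\nu(q)$ is the number of residue classes modulo $q$ occupied by $\mathcal H$. Logarithms are natural. Theorem. Fix an integer $t\ge1$. There are a constant $C_t>0$, a real number $X_0=X_0(t)$ and a nonnegative integer $A=A_t$, all depending only on $t$, such that the following hold. (i) For all real $X\ge X_0$ and all $\mathbf g\in\mathbb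 Z_{\ge0}^t$, $$\mu_X^{(t)}(\mathbf g)\le C_t\,\frac{\mathfrak S(0,H_1,\dots,H_t)}{(\log X)^t}.$$ (ii) For every real $K>0$ there is a constant $D_{t,K}>0$ such that for all real $X\ge X_0$ and all $\mathbf g\in\mathbb Z_{\ge0}^t$ with $H_t\le KX$, $$C_t\,\frac{\mathfrak S(0,H_1,\dots,H_t)}{(\log X)^t}\le D_{t,K}\,\frac{(\log\log(3X))^{A}}{(\log X)^t}.$$ (iii) There is a constant $D_t>0$ such that for all real $X\ge X_0$ and all $\mathbf g\in\mathbb Z_{\ge0}^t$ (with no restriction on $H_t$), $$\mu_X^{(t)}(\mathbf g)\le D_t\,\frac{(\log\log(3X))^{A}}{(\log X)^t}.$$ -/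

import Mathlib

noncomputable section

namespace PrimeGaps

/-- The next prime `p⁺`: the least prime strictly greater than `p`. -/
def nextPrime (p : ℕ) : ℕ := Nat.find (Nat.exists_infinite_primes (p + 1))

/-- The consecutive gap vector `(g(p), g(p⁺), …, g(p^{+(t-1)}))`, where `g(q) = q⁺ - q` and
`p^{+(j)}` is the `j`-th successor prime of `p`. -/
def gapVector (t : ℕ) (p : ℕ) : Fin t → ℕ :=
  fun i => nextPrime (nextPrime^[(i : ℕ)] p) - nextPrime^[(i : ℕ)] p

/-- The set of primes in the dyadic interval `[X, 2X]`. -/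
def dyadicPrimes (X : ℝ) : Set ℕ := {p | p.Prime ∧ X ≤ (p : ℝ) ∧ (p : ℝ) ≤ 2 * X}

/-- The law of `gapVector t P` for `P` uniform among the primes in `[X, 2X]`. -/
def gapLaw (t : ℕ) (X : ℝ) : MeasureTheory.Measure (Fin t → ℕ) :=
  (ProbabilityTheory.uniformOn (dyadicPrimes X)).map (gapVector t)

/-- The cumulative offset `H_k = g_1 + ⋯ + g_k` for `0 ≤ k ≤ t` (so `H_0 = 0`). -/
def offset {t : ℕ} (g : Fin t → ℕ) (k : Fin (t + 1)) : ℕ :=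
  ∑ i : Fin t with i.val < k.val, g i

/-- The set of offsets `{H_0, H_1, …, H_t}`. -/
def offsetSet {t : ℕ} (g : Fin t → ℕ) : Finset ℕ := Finset.univ.image (offset g)

/-- The number of residue classes modulo `p` occupied by `H`. -/
def residueCount (H : Finset ℕ) (p : ℕ) : ℕ := (H.image (fun h => h % p)).card

/-- The local factor at `p` of the singular series of `H`. -/
def singularFactor (H : Finset ℕ) (p : ℕ) : ℝ :=
  (1 - (residueCount H p : ℝ) / p) * ((1 - 1 / (p : ℝ)) ^ H.card)⁻¹

/-- The Hardy–Littlewood singular series of a finite set `H`: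
`∏_p (1 - ν_H(p)/p) (1 - 1/p)^{-|H|}`; the product converges by `multipliable_singularFactor`. -/
def singularSeries (H : Finset ℕ) : ℝ := ∏' p : Nat.Primes, singularFactor H p

theorem one_sub_pow_le (k : ℕ) (x : ℝ) (h0 : 0 ≤ x) (h1 : x ≤ 1) :
    (1 - x) ^ k ≤ 1 - k * x + (k : ℝ) ^ 2 * x ^ 2 := by
  induction k with
  | zero => simp
  | succ n ih =>
    have h := mul_le_mul_of_nonneg_right ih (sub_nonneg.2 h1)
    rw [pow_succ]
    push_cast
    have hn : (0 : ℝ) ≤ n := Nat.cast_nonneg n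
    have h3 : 0 ≤ (n : ℝ) ^ 2 * x ^ 3 := by positivity
    nlinarith [mul_nonneg hn (sq_nonneg x), sq_nonneg x]

theorem abs_singularFactor_sub_one_le (H : Finset ℕ) (p : ℕ) (hp : 2 ≤ p)
    (hH : ∀ h ∈ H, h < p) :
    |singularFactor H p - 1| ≤ (2 : ℝ) ^ H.card * (H.card : ℝ) ^ 2 * (1 / (p : ℝ) ^ 2) := by
  have hcard : residueCount H p = H.card := by
    unfold residueCount
    apply Finset.card_image_of_injOn
    intro a ha b hb hab
    simpa [Nat.mod_eq_of_lt (hH a ha), Nat.mod_eq_of_lt (hH b hb)] using hab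
  unfold singularFactor
  rw [hcard]
  set k := H.card
  have hp' : (2 : ℝ) ≤ p := by exact_mod_cast hp
  have hx2 : 1 / (p : ℝ) ≤ 1 / 2 := one_div_le_one_div_of_le (by norm_num) hp'
  have hx0 : 0 ≤ 1 / (p : ℝ) := by positivity
  have e1 : (k : ℝ) / p = k * (1 / (p : ℝ)) := by ring
  have e2 : 1 / (p : ℝ) ^ 2 = (1 / (p : ℝ)) ^ 2 := by simp
  rw [e1, e2]
  generalize 1 / (p : ℝ) = x at hx2 hx0
  have hpos : 0 < (1 - x) ^ k := pow_pos (by linarith) k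
  have hlow : 1 - k * x ≤ (1 - x) ^ k := by
    have := one_add_mul_le_pow (a := -x) (by linarith) k
    calc 1 - k * x = 1 + k * (-x) := by ring
      _ ≤ (1 + -x) ^ k := this
      _ = (1 - x) ^ k := by ring
  have hup := one_sub_pow_le k x hx0 (by linarith)
  have hinv : ((1 - x) ^ k)⁻¹ ≤ 2 ^ k := by
    rw [← inv_pow]
    apply pow_le_pow_left₀ (inv_nonneg.2 (by linarith))
    rw [inv_le_comm₀ (by linarith) (by norm_num)]
    linarith
  have e3 : (1 - k * x) * ((1 - x) ^ k)⁻¹ - 1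
      = -(((1 - x) ^ k - (1 - k * x)) * ((1 - x) ^ k)⁻¹) := by
    field_simp
    ring
  rw [e3, abs_neg, abs_of_nonneg (mul_nonneg (by linarith) (inv_nonneg.2 hpos.le))]
  calc ((1 - x) ^ k - (1 - k * x)) * ((1 - x) ^ k)⁻¹
      ≤ ((k : ℝ) ^ 2 * x ^ 2) * 2 ^ k :=
        mul_le_mul (by linarith) hinv (inv_nonneg.2 hpos.le) (by positivity)
    _ = 2 ^ k * (k : ℝ) ^ 2 * x ^ 2 := by ring

/-- The Euler product defining the singular series converges. -/
theorem multipliable_singularFactor (H : Finset ℕ) :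
    Multipliable (fun p : Nat.Primes => singularFactor H p) := by
  have hs : Summable (fun p : Nat.Primes => singularFactor H p - 1) := by
    have hb : Summable (fun p : Nat.Primes =>
        (2 : ℝ) ^ H.card * (H.card : ℝ) ^ 2 * (1 / ((p : ℕ) : ℝ) ^ 2)) :=
      ((Real.summable_one_div_nat_pow.2 one_lt_two).comp_injective
        Subtype.val_injective).mul_left _
    refine hb.of_norm_bounded_eventually ?_
    have hfin : {p : Nat.Primes | (p : ℕ) ≤ H.sup id}.Finite :=
      Set.Finite.preimage Subtype.val_injective.injOn (Set.finite_Iic (H.sup id))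
    refine hfin.subset ?_
    intro p hp
    by_contra hlt
    apply hp
    change ‖singularFactor H p.1 - 1‖ ≤ _
    refine (Real.norm_eq_abs _).trans_le ?_
    refine abs_singularFactor_sub_one_le H p p.2.two_le fun h hh => ?_
    have hle : h ≤ H.sup id := Finset.le_sup (f := id) hh
    have hlt' : ¬ (p.1 ≤ H.sup id) := hlt
    omega
  have := Real.multipliable_one_add_of_summable hs
  simpa using this

end PrimeGaps

end

/-!
If `p` is prime and has gap vector `g`, then all the numbers `p + h` with `h` in the offset set of
`g` are prime. Selberg's sieve, applied to the polynomial `∏ h, (n + h)` with level a small power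
of `X`, bounds the number of such `p` by a constant times `X ∏_{p ≤ z} (1 - ν(p) / p)`, and by
Mertens' bound this product is at most a constant times `𝔖 / (log X) ^ (t + 1)`. Selberg's
quadratic form is bounded below uniformly in the offsets by Rankin's trick. If the offsets cover
all residues modulo some `p ≤ z`, there is nothing to count. Dividing by Chebyshev's lower bound
for the number of primes in `[X, 2X]` gives (i).

For (ii), a local factor of `𝔖` exceeds `1` only at a prime dividing the product of the differences
of the offsets. That product is at most `X ^ O(1)`, so the contribution of these primes is
controlled by that of the primes up to `O(log X)`, which is a power of `log log X`. Finally,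
iterated use of Bertrand's postulate shows that no gap vector has `H_t > 2 ^ (t + 1) X`, so (iii)
follows from (i) and (ii).
-/

namespace PrimeGaps

open Finset

section Mertens

theorem one_lt_cast_prime {p : ℕ} (hp : p.Prime) : (1 : ℝ) < p :=
  Nat.one_lt_cast.2 hp.one_lt

theorem one_sub_one_div_prime_pos {p : ℕ} (hp : p.Prime) : 0 < 1 - 1 / (p : ℝ) :=
  sub_pos.2 ((div_lt_one (by exact_mod_cast hp.pos)).2 (one_lt_cast_prime hp))

theorem prod_pow_div_primesLE_dvd_factorial (n : ℕ) :
    ∏ p ∈ n.primesLE, p ^ (n / p) ∣ n.factorial := by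
  refine prod_dvd_of_isRelPrime (fun p hp q hq hpq => ?_) fun p hp => ?_
  · exact Nat.coprime_iff_isRelPrime.1 (Nat.Coprime.pow _ _ ((Nat.coprime_primes
      (Nat.prime_of_mem_primesLE hp) (Nat.prime_of_mem_primesLE hq)).2 hpq))
  · have hpp := Nat.prime_of_mem_primesLE hp
    refine dvd_trans ?_ (Nat.factorial_dvd_factorial (Nat.mul_div_le n p))
    rw [hpp.pow_dvd_iff_le_factorization (Nat.factorial_ne_zero _),
      Nat.factorization_factorial_mul hpp]
    exact Nat.le_add_left _ _

theorem sum_div_mul_log_primesLE_le (n : ℕ) :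
    ∑ p ∈ n.primesLE, ((n / p : ℕ) : ℝ) * Real.log p ≤ n * Real.log n := by
  have hpos : ∀ p ∈ n.primesLE, (0 : ℝ) < (p : ℝ) ^ (n / p) := fun p hp =>
    pow_pos (Nat.cast_pos.2 (Nat.prime_of_mem_primesLE hp).pos) _
  have hle : ∏ p ∈ n.primesLE, (p : ℝ) ^ (n / p) ≤ (n : ℝ) ^ n := by
    exact_mod_cast (Nat.le_of_dvd (Nat.factorial_pos n)
      (prod_pow_div_primesLE_dvd_factorial n)).trans (Nat.factorial_le_pow n)
  have hlog := Real.log_le_log (prod_pos hpos) hle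
  rw [Real.log_prod fun p hp => (hpos p hp).ne'] at hlog
  simpa only [Real.log_pow] using hlog

theorem sum_log_div_primesLE_le (n : ℕ) :
    ∑ p ∈ n.primesLE, Real.log p / p ≤ Real.log n + Real.log 4 := by
  rcases n.eq_zero_or_pos with rfl | hn
  · simp [Real.log_nonneg]
  have hn' : (0 : ℝ) < n := Nat.cast_pos.2 hn
  have htheta : ∑ p ∈ n.primesLE, Real.log p ≤ Real.log 4 * n := by
    rw [← Chebyshev.theta_eq_sum_primesLE_log]
    exact Chebyshev.theta_le_log4_mul_x hn'.le
  have hfloor : ∑ p ∈ n.primesLE, (n : ℝ) * (Real.log p / p) ≤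
      ∑ p ∈ n.primesLE, (((n / p : ℕ) : ℝ) * Real.log p + Real.log p) := by
    refine sum_le_sum fun p _ => ?_
    have hdiv : (n : ℝ) / p ≤ ((n / p : ℕ) : ℝ) + 1 := by
      rw [← Nat.floor_div_eq_div (K := ℝ)]
      exact (Nat.lt_floor_add_one _).le
    calc (n : ℝ) * (Real.log p / p) = n / p * Real.log p := by ring
      _ ≤ (((n / p : ℕ) : ℝ) + 1) * Real.log p :=
          mul_le_mul_of_nonneg_right hdiv (Real.log_natCast_nonneg p)
      _ = _ := by ring
  rw [← mul_sum, sum_add_distrib] at hfloor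
  refine le_of_mul_le_mul_left ?_ hn'
  linarith [sum_div_mul_log_primesLE_le n]

theorem log_le_prod_primesLE_inv_one_sub_inv (n : ℕ) :
    Real.log n ≤ ∏ p ∈ n.primesLE, (1 - 1 / (p : ℝ))⁻¹ := by
  let f : ℕ →* ℝ := ⟨⟨fun m => (m : ℝ)⁻¹, by simp⟩, fun a b => by simp [mul_comm]⟩
  have hf : ∀ {p : ℕ}, p.Prime → ‖f p‖ < 1 := fun {p} hp => by
    simpa [f] using inv_lt_one_of_one_lt₀ (one_lt_cast_prime hp)
  have hprod := (EulerProduct.summable_and_hasSum_smoothNumbers_prod_primesBelow_geometric hf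
    (n + 1)).2
  have hsmooth : ∀ m ∈ Icc 1 n, m ∈ (n + 1).smoothNumbers := fun m hm =>
    Nat.mem_smoothNumbers_of_lt (mem_Icc.1 hm).1 (Nat.lt_succ_of_le (mem_Icc.1 hm).2)
  have hharmonic : ∑ m ∈ Icc 1 n, (m : ℝ)⁻¹ ≤ ∏ p ∈ (n + 1).primesBelow, (1 - f p)⁻¹ := by
    rw [← sum_subtype_of_mem (fun m : ℕ => (m : ℝ)⁻¹) hsmooth]
    exact sum_le_hasSum _ (fun m _ => inv_nonneg.2 (Nat.cast_nonneg (m : ℕ))) hprod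
  have hlog := log_le_harmonic_floor (n : ℝ) (Nat.cast_nonneg n)
  rw [Nat.floor_natCast, harmonic_eq_sum_Icc] at hlog
  push_cast at hlog
  simpa only [one_div, Nat.primesLE, f, MonoidHom.coe_mk, OneHom.coe_mk] using
    hlog.trans hharmonic

theorem prod_primesLE_one_sub_inv_le {n : ℕ} (hn : 2 ≤ n) :
    ∏ p ∈ n.primesLE, (1 - 1 / (p : ℝ)) ≤ (Real.log n)⁻¹ := by
  have h := log_le_prod_primesLE_inv_one_sub_inv n
  rw [prod_inv_distrib] at h
  have hl : 0 < Real.log n := Real.log_pos (Nat.one_lt_cast.2 hn)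
  exact (le_inv_comm₀ hl (inv_pos.1 (hl.trans_le h))).1 h

theorem log_four_le_two_mul_log {n : ℕ} (hn : 2 ≤ n) : Real.log 4 ≤ 2 * Real.log n := by
  rw [show (4 : ℝ) = 2 ^ 2 by norm_num, Real.log_pow]
  have := Real.log_le_log two_pos (Nat.ofNat_le_cast.2 hn)
  push_cast
  linarith

theorem sum_inv_primesLE_sq_sdiff_le {a : ℕ} (ha : 2 ≤ a) :
    ∑ p ∈ (a ^ 2).primesLE \ a.primesLE, 1 / (p : ℝ) ≤ 4 := by
  have hla : 0 < Real.log a := Real.log_pos (Nat.one_lt_cast.2 ha)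
  have hterm : ∀ p ∈ (a ^ 2).primesLE \ a.primesLE,
      1 / (p : ℝ) ≤ (Real.log a)⁻¹ * (Real.log p / p) := fun p hp => by
    obtain ⟨hple, hpgt⟩ := mem_sdiff.1 hp
    have hap : a < p := by
      by_contra! hle
      exact hpgt (Nat.mem_primesLE.2 ⟨hle, Nat.prime_of_mem_primesLE hple⟩)
    rw [← mul_div_assoc]
    refine div_le_div_of_nonneg_right ?_ (Nat.cast_nonneg p)
    rw [inv_mul_eq_div, one_le_div hla]
    exact Real.log_le_log (by positivity) (by exact_mod_cast hap.le)
  calc ∑ p ∈ (a ^ 2).primesLE \ a.primesLE, 1 / (p : ℝ)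
      ≤ (Real.log a)⁻¹ * ∑ p ∈ (a ^ 2).primesLE \ a.primesLE, Real.log p / p := by
        rw [mul_sum]
        exact sum_le_sum hterm
    _ ≤ (Real.log a)⁻¹ * ∑ p ∈ (a ^ 2).primesLE, Real.log p / p := by
        refine mul_le_mul_of_nonneg_left ?_ (inv_nonneg.2 hla.le)
        exact sum_le_sum_of_subset_of_nonneg sdiff_subset fun p _ _ =>
          div_nonneg (Real.log_natCast_nonneg p) (Nat.cast_nonneg p)
    _ ≤ 4 := by
        rw [inv_mul_le_iff₀ hla]
        have hsum := sum_log_div_primesLE_le (a ^ 2)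
        push_cast at hsum
        rw [Real.log_pow] at hsum
        have := log_four_le_two_mul_log ha
        push_cast at hsum
        linarith

theorem sum_inv_primesLE_two_pow_two_pow_le (m : ℕ) :
    ∑ p ∈ Nat.primesLE (2 ^ 2 ^ m), 1 / (p : ℝ) ≤ 4 * m + 1 := by
  induction m with
  | zero =>
    rw [show Nat.primesLE (2 ^ 2 ^ 0) = {2} by decide]
    norm_num
  | succ m ih =>
    have hsq : 2 ^ 2 ^ (m + 1) = (2 ^ 2 ^ m) ^ 2 := by rw [← pow_mul, pow_succ]
    have htwo : 2 ≤ 2 ^ 2 ^ m := Nat.le_self_pow (by positivity) 2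
    rw [hsq, ← sum_sdiff (Nat.primesLE_mono (Nat.le_self_pow two_ne_zero (2 ^ 2 ^ m)))]
    push_cast
    linarith [sum_inv_primesLE_sq_sdiff_le htwo]

theorem exists_le_two_pow_two_pow {n : ℕ} (hn : 2 ≤ n) :
    ∃ m : ℕ, n ≤ 2 ^ 2 ^ m ∧ (2 : ℝ) ^ m ≤ 2 / Real.log 2 * Real.log n := by
  set L := Nat.log 2 n
  have hL : L ≠ 0 := (Nat.log_pos one_lt_two hn).ne'
  refine ⟨Nat.log 2 L + 1, ?_, ?_⟩
  · exact (Nat.lt_pow_succ_log_self one_lt_two n).le.trans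
      (Nat.pow_le_pow_right two_pos (Nat.lt_pow_succ_log_self one_lt_two L))
  · have hpow : (2 : ℝ) ^ Nat.log 2 L ≤ L := by exact_mod_cast Nat.pow_log_le_self 2 hL
    have hlog : (L : ℝ) * Real.log 2 ≤ Real.log n := by
      rw [← Real.log_pow]
      exact Real.log_le_log (by positivity)
        (by exact_mod_cast Nat.pow_log_le_self 2 (by omega : n ≠ 0))
    rw [div_mul_eq_mul_div, le_div_iff₀ (Real.log_pos one_lt_two), pow_succ]
    nlinarith [Real.log_pos one_lt_two]

theorem inv_one_sub_le_exp_two_mul {x : ℝ} (hx₀ : 0 ≤ x) (hx : x ≤ 1 / 2) :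
    (1 - x)⁻¹ ≤ Real.exp (2 * x) := by
  refine le_trans ?_ (Real.add_one_le_exp _)
  rw [inv_le_iff_one_le_mul₀ (by linarith)]
  nlinarith

theorem prod_primesLE_inv_one_sub_inv_le_exp (n : ℕ) :
    ∏ p ∈ n.primesLE, (1 - 1 / (p : ℝ))⁻¹ ≤
      Real.exp (2 * ∑ p ∈ n.primesLE, 1 / (p : ℝ)) := by
  rw [mul_sum, Real.exp_sum]
  refine prod_le_prod (fun p hp => ?_) fun p hp => ?_
  · exact inv_nonneg.2 (one_sub_one_div_prime_pos (Nat.prime_of_mem_primesLE hp)).le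
  · exact inv_one_sub_le_exp_two_mul (by positivity) (one_div_le_one_div_of_le two_pos
      (Nat.ofNat_le_cast.2 (Nat.two_le_of_mem_primesLE hp)))

/-- The exponent is far from Mertens' optimal `1`, but any fixed power serves here. -/
theorem exists_prod_primesLE_inv_one_sub_inv_le :
    ∃ C : ℝ, 0 < C ∧ ∀ n : ℕ, 2 ≤ n →
      ∏ p ∈ n.primesLE, (1 - 1 / (p : ℝ))⁻¹ ≤ C * Real.log n ^ 16 := by
  refine ⟨Real.exp 2 * (2 / Real.log 2) ^ 16, by positivity, fun n hn => ?_⟩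
  obtain ⟨m, hnm, hm⟩ := exists_le_two_pow_two_pow hn
  have hsum : ∑ p ∈ n.primesLE, 1 / (p : ℝ) ≤ 4 * m + 1 :=
    (sum_le_sum_of_subset_of_nonneg (Nat.primesLE_mono hnm) fun p _ _ => by positivity).trans
      (sum_inv_primesLE_two_pow_two_pow_le m)
  have hexp : Real.exp 1 ≤ 2 ^ 2 := by linarith [Real.exp_one_lt_d9]
  calc ∏ p ∈ n.primesLE, (1 - 1 / (p : ℝ))⁻¹
      ≤ Real.exp (2 * ∑ p ∈ n.primesLE, 1 / (p : ℝ)) := prod_primesLE_inv_one_sub_inv_le_exp n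
    _ ≤ Real.exp (2 + (8 * m : ℕ) * 1) := by
        apply Real.exp_le_exp.2
        push_cast
        linarith
    _ = Real.exp 2 * Real.exp 1 ^ (8 * m) := by rw [Real.exp_add, Real.exp_nat_mul]
    _ ≤ Real.exp 2 * (2 ^ 2) ^ (8 * m) := by gcongr
    _ = Real.exp 2 * (2 ^ m) ^ 16 := by rw [← pow_mul, ← pow_mul]; congr 2; ring
    _ ≤ Real.exp 2 * (2 / Real.log 2 * Real.log n) ^ 16 := by gcongr
    _ = _ := by ring

end Mertens

section Chebyshev

theorem prod_primesLE_pow_factorization_centralBinom (n : ℕ) :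
    ∏ p ∈ (2 * n).primesLE, p ^ n.centralBinom.factorization p = n.centralBinom := by
  rw [Nat.primesLE_eq_filter_range, prod_filter_of_ne,
    Nat.prod_pow_factorization_centralBinom]
  intro p _ h
  contrapose! h
  rw [Nat.factorization_eq_zero_of_not_prime _ h, pow_zero]

theorem pow_factorization_centralBinom_le {n p : ℕ} (hn : 2 < n) (hp : p.Prime) :
    p ^ n.centralBinom.factorization p ≤
      (if p ≤ Nat.sqrt (2 * n) then 2 * n else 1) * (if p ≤ 2 * n / 3 then p else 1) *
        (if n < p then 2 * n else 1) := by
  have hle : p ^ n.centralBinom.factorization p ≤ 2 * n :=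
    Nat.pow_factorization_choose_le (by omega)
  have h₁ : 1 ≤ if p ≤ Nat.sqrt (2 * n) then 2 * n else 1 := by split_ifs <;> omega
  have h₂ : 1 ≤ if p ≤ 2 * n / 3 then p else 1 := by split_ifs <;> grind [hp.one_lt]
  have h₃ : 1 ≤ if n < p then 2 * n else 1 := by split_ifs <;> omega
  by_cases hlarge : n < p
  · rw [if_pos hlarge]
    exact hle.trans (Nat.le_mul_of_pos_left _ (Nat.mul_pos h₁ h₂))
  refine le_trans ?_ (Nat.le_mul_of_pos_right _ h₃)
  by_cases hsmall : p ≤ Nat.sqrt (2 * n)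
  · rw [if_pos hsmall]
    exact hle.trans (Nat.le_mul_of_pos_right _ h₂)
  refine le_trans ?_ (Nat.le_mul_of_pos_left _ h₁)
  by_cases hthird : p ≤ 2 * n / 3
  · rw [if_pos hthird]
    exact (Nat.pow_le_pow_right hp.pos (Nat.factorization_choose_le_one
      (Nat.sqrt_lt'.1 (not_le.1 hsmall)))).trans_eq (pow_one p)
  · rw [Nat.factorization_centralBinom_of_two_mul_self_lt_three_mul hn (by omega) (by omega),
      pow_zero]
    exact h₂

theorem centralBinom_le_mul_pow_card {n : ℕ} (hn : 2 < n) :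
    n.centralBinom ≤ (2 * n) ^ Nat.sqrt (2 * n) * 4 ^ (2 * n / 3) *
      (2 * n) ^ #{p ∈ (2 * n).primesLE | n < p} := by
  have hprod := prod_le_prod' fun p hp =>
    pow_factorization_centralBinom_le hn (Nat.prime_of_mem_primesLE (n := 2 * n) hp)
  rw [prod_primesLE_pow_factorization_centralBinom, prod_mul_distrib, prod_mul_distrib] at hprod
  simp only [← prod_filter, prod_const] at hprod
  refine hprod.trans (Nat.mul_le_mul_right _ (Nat.mul_le_mul ?_ ?_))
  · refine Nat.pow_le_pow_right (by omega) ?_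
    have hsub : {p ∈ (2 * n).primesLE | p ≤ Nat.sqrt (2 * n)} ⊆ Icc 1 (Nat.sqrt (2 * n)) :=
      fun p hp => mem_Icc.2
        ⟨(Nat.prime_of_mem_primesLE (mem_filter.1 hp).1).pos, (mem_filter.1 hp).2⟩
    simpa using card_le_card hsub
  · refine le_trans ?_ (primorial_le_four_pow (2 * n / 3))
    rw [primorial_eq_prod_primesLE]
    refine prod_le_prod_of_subset_of_one_le' (fun p hp => ?_) fun p hp _ =>
      (Nat.prime_of_mem_primesLE hp).pos
    exact Nat.mem_primesLE.2 ⟨(mem_filter.1 hp).2, Nat.prime_of_mem_primesLE (mem_filter.1 hp).1⟩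

theorem log_four_mul_le_card_mul_log {n : ℕ} (hn : 4 ≤ n) :
    n * Real.log 4 / 3 ≤ √(2 * n) * Real.log (2 * n) + Real.log (2 * n) +
      #{p ∈ (2 * n).primesLE | n < p} * Real.log (2 * n) := by
  have hn₀ : (0 : ℝ) < n := by positivity
  have hlog : 0 ≤ Real.log (2 * n) := by exact_mod_cast Real.log_natCast_nonneg (2 * n)
  have hpow : (4 : ℝ) ^ n ≤ n * ((2 * n) ^ Nat.sqrt (2 * n) * 4 ^ (2 * n / 3) *
      (2 * n) ^ #{p ∈ (2 * n).primesLE | n < p}) := by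
    exact_mod_cast (Nat.four_pow_lt_mul_centralBinom n hn).le.trans
      (Nat.mul_le_mul_left n (centralBinom_le_mul_pow_card (by omega : 2 < n)))
  have hl := Real.log_le_log (by positivity) hpow
  rw [Real.log_mul (by positivity) (by positivity), Real.log_mul (by positivity) (by positivity),
    Real.log_mul (by positivity) (by positivity), Real.log_pow, Real.log_pow, Real.log_pow,
    Real.log_pow] at hl
  have hsqrt : ((Nat.sqrt (2 * n) : ℕ) : ℝ) * Real.log (2 * n) ≤ √(2 * n) * Real.log (2 * n) :=
    mul_le_mul_of_nonneg_right
      (by exact_mod_cast Real.nat_sqrt_le_real_sqrt (a := 2 * n)) hlog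
  have hthird : ((2 * n / 3 : ℕ) : ℝ) * Real.log 4 ≤ 2 * n / 3 * Real.log 4 :=
    mul_le_mul_of_nonneg_right
      (by exact_mod_cast Nat.cast_div_le (α := ℝ) (m := 2 * n) (n := 3)) (by positivity)
  have hln : Real.log n ≤ Real.log (2 * n) := Real.log_le_log hn₀ (by linarith)
  linarith

open Filter Asymptotics in
theorem eventually_sqrt_mul_log_add_log_le {c : ℝ} (hc : 0 < c) :
    ∀ᶠ x : ℝ in atTop, √x * Real.log x + Real.log x ≤ c * x := by
  have hsqrt : (fun x : ℝ => √x * Real.log x) =o[atTop] fun x => x := by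
    have := (isBigO_refl (fun x : ℝ => √x) atTop).mul_isLittleO
      (isLittleO_log_rpow_atTop (r := 1 / 2) (by norm_num))
    refine this.congr' EventuallyEq.rfl ?_
    filter_upwards [eventually_ge_atTop 0] with x hx
    rw [← Real.sqrt_eq_rpow, Real.mul_self_sqrt hx]
  filter_upwards [(hsqrt.add Real.isLittleO_log_id_atTop).def hc, eventually_ge_atTop 0]
    with x hx hx₀
  have := (Real.le_norm_self _).trans hx
  rwa [Real.norm_of_nonneg hx₀] at this

theorem eventually_le_card_primesLE_two_mul_filter :
    ∀ᶠ n : ℕ in Filter.atTop,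
      (1 / 6 : ℝ) * n / Real.log (2 * n) ≤ #{p ∈ (2 * n).primesLE | n < p} := by
  have htwo : Filter.Tendsto (fun n : ℕ => (2 * n : ℝ)) Filter.atTop Filter.atTop :=
    tendsto_natCast_atTop_atTop.const_mul_atTop two_pos
  filter_upwards [htwo.eventually (eventually_sqrt_mul_log_add_log_le (c := 1 / 12) (by norm_num)),
    Filter.eventually_ge_atTop 4] with n hn hn₄
  have hn₄' : (4 : ℝ) ≤ n := Nat.ofNat_le_cast.2 hn₄
  have hlog₄ : 1 ≤ Real.log 4 := by
    rw [show (4 : ℝ) = 2 ^ 2 by norm_num, Real.log_pow]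
    push_cast
    linarith [Real.log_two_gt_d9]
  rw [div_le_iff₀ (Real.log_pos (by linarith))]
  nlinarith [log_four_mul_le_card_mul_log hn₄]

end Chebyshev

section SelbergSieve

open ArithmeticFunction
open scoped ArithmeticFunction.Moebius

theorem sum_moebius_divisors (n : ℕ) :
    ∑ d ∈ n.divisors, (μ d : ℝ) = if n = 1 then 1 else 0 := by
  have hint : ∑ d ∈ n.divisors, μ d = if n = 1 then 1 else 0 := by
    rw [← coe_mul_zeta_apply, moebius_mul_coe_zeta, one_apply]
  exact_mod_cast congrArg (Int.cast : ℤ → ℝ) hint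

theorem filter_dvd_dvd_divisors {P l e : ℕ} (hP : P ≠ 0) (hle : l * e ∣ P) :
    {d ∈ P.divisors | l ∣ d ∧ d ∣ l * e} = e.divisors.image (l * ·) := by
  have hle₀ : l * e ≠ 0 := ne_zero_of_dvd_ne_zero hP hle
  ext d
  simp only [mem_filter, Nat.mem_divisors, mem_image]
  constructor
  · rintro ⟨-, ⟨c, rfl⟩, hc⟩
    exact ⟨c, ⟨(Nat.mul_dvd_mul_iff_left (Nat.pos_of_ne_zero (left_ne_zero_of_mul hle₀))).1 hc,
      right_ne_zero_of_mul hle₀⟩, rfl⟩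
  · rintro ⟨c, ⟨hc, -⟩, rfl⟩
    exact ⟨⟨(mul_dvd_mul_left l hc).trans hle, hP⟩, dvd_mul_right l c, mul_dvd_mul_left l hc⟩

theorem sum_moebius_interval {P l m : ℕ} (hP : Squarefree P) (hm : m ∣ P) :
    ∑ d ∈ P.divisors with l ∣ d ∧ d ∣ m, (μ d : ℝ) = if l = m then (μ m : ℝ) else 0 := by
  by_cases hlm : l ∣ m
  swap
  · rw [if_neg fun h : l = m => hlm (h ▸ dvd_rfl), filter_false_of_mem, sum_empty]
    exact fun d _ h => hlm (h.1.trans h.2)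
  obtain ⟨e, rfl⟩ := hlm
  have hsq : Squarefree (l * e) := hP.squarefree_of_dvd hm
  have hl : l ≠ 0 := left_ne_zero_of_mul hsq.ne_zero
  have hmul : ∀ c ∈ e.divisors, (μ (l * c) : ℝ) = μ l * μ c := fun c hc => by
    rw [isMultiplicative_moebius.map_mul_of_coprime, Int.cast_mul]
    exact (Nat.squarefree_mul_iff.1 hsq).1.coprime_dvd_right (Nat.dvd_of_mem_divisors hc)
  rw [filter_dvd_dvd_divisors hP.ne_zero hm, sum_image (mul_right_injective₀ hl).injOn,
    sum_congr rfl hmul, ← mul_sum, sum_moebius_divisors]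
  by_cases he : e = 1
  · simp [he]
  · rw [if_neg he, if_neg fun h => he (mul_left_cancel₀ hl (h.symm.trans (mul_one l).symm)),
      mul_zero]

theorem card_filter_divisors_le (n B : ℕ) : #{d ∈ n.divisors | d ≤ B} ≤ B := by
  refine (card_le_card (t := Icc 1 B) fun d hd => ?_).trans (by simp)
  exact mem_Icc.2 ⟨Nat.pos_of_mem_divisors (mem_filter.1 hd).1, (mem_filter.1 hd).2⟩

variable {s : BoundingSieve} {D : ℕ}

variable (s D) in
/-- The sum `∑_{l ∣ P, l ≤ D} h(l)`, whose reciprocal is the optimal value of the quadratic form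
in Selberg's sieve of level `D`. -/
noncomputable def selbergSum : ℝ := ∑ l ∈ s.prodPrimes.divisors with l ≤ D, s.selbergTerms l

variable (s D) in
/-- Selberg's weights `λ_d`, supported on `d ≤ D` and normalised by `λ_1 = 1`, which minimise the
main term of the `Λ²` sieve. -/
noncomputable def selbergWeight (d : ℕ) : ℝ :=
  (s.nu d)⁻¹ * (μ d * ∑ m ∈ s.prodPrimes.divisors with d ∣ m ∧ m ≤ D, s.selbergTerms m) /
    selbergSum s D

theorem selbergTerms_pos_of_mem_divisors {l : ℕ} (hl : l ∈ s.prodPrimes.divisors) :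
    0 < s.selbergTerms l :=
  BoundingSieve.selbergTerms_pos (Nat.dvd_of_mem_divisors hl)

theorem one_le_selbergSum (hD : 1 ≤ D) : 1 ≤ selbergSum s D := by
  rw [← (BoundingSieve.selbergTerms_isMultiplicative (s := s)).map_one]
  exact single_le_sum (f := fun l => s.selbergTerms l)
    (fun l hl => (selbergTerms_pos_of_mem_divisors (mem_filter.1 hl).1).le)
    (mem_filter.2 ⟨Nat.one_mem_divisors.2 BoundingSieve.prodPrimes_ne_zero, hD⟩)

theorem selbergWeight_one (hD : 1 ≤ D) : selbergWeight s D 1 = 1 := by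
  have hsum : ∑ m ∈ s.prodPrimes.divisors with 1 ∣ m ∧ m ≤ D, s.selbergTerms m =
      selbergSum s D := by
    simp only [one_dvd, true_and, selbergSum]
  rw [selbergWeight, hsum, s.nu_mult.map_one, moebius_apply_one, Int.cast_one, inv_one, one_mul,
    one_mul]
  exact div_self (one_pos.trans_le (one_le_selbergSum hD)).ne'

theorem nu_mul_selbergWeight {d : ℕ} (hd : d ∣ s.prodPrimes) :
    s.nu d * selbergWeight s D d = ∑ m ∈ s.prodPrimes.divisors with m ≤ D,
      s.selbergTerms m / selbergSum s D * if d ∣ m then (μ d : ℝ) else 0 := by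
  have hsum : ∑ m ∈ s.prodPrimes.divisors with d ∣ m ∧ m ≤ D, s.selbergTerms m =
      ∑ m ∈ s.prodPrimes.divisors with m ≤ D, if d ∣ m then s.selbergTerms m else 0 := by
    rw [← sum_filter, filter_filter]
    simp only [and_comm]
  rw [selbergWeight, hsum, mul_div_assoc, mul_inv_cancel_left₀ (BoundingSieve.nu_ne_zero hd),
    mul_sum, sum_div]
  refine sum_congr rfl fun m _ => ?_
  split_ifs <;> ring

theorem sum_nu_mul_selbergWeight (l : ℕ) :
    ∑ d ∈ s.prodPrimes.divisors, (if l ∣ d then s.nu d * selbergWeight s D d else 0) =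
      ∑ m ∈ s.prodPrimes.divisors with m ≤ D,
        if l = m then μ m * s.selbergTerms m / selbergSum s D else 0 := by
  calc _ = ∑ d ∈ s.prodPrimes.divisors with l ∣ d, ∑ m ∈ s.prodPrimes.divisors with m ≤ D,
          s.selbergTerms m / selbergSum s D * if d ∣ m then (μ d : ℝ) else 0 := by
        rw [← sum_filter]
        exact sum_congr rfl fun d hd =>
          nu_mul_selbergWeight (Nat.dvd_of_mem_divisors (mem_filter.1 hd).1)
    _ = ∑ m ∈ s.prodPrimes.divisors with m ≤ D, s.selbergTerms m / selbergSum s D *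
          ∑ d ∈ s.prodPrimes.divisors with l ∣ d ∧ d ∣ m, (μ d : ℝ) := by
        rw [sum_comm]
        simp only [← mul_sum, ← sum_filter, filter_filter]
    _ = _ := sum_congr rfl fun m hm => by
        rw [sum_moebius_interval s.prodPrimes_squarefree
          (Nat.dvd_of_mem_divisors (mem_filter.1 hm).1)]
        split_ifs <;> ring

theorem mainSum_lambdaSquared_selbergWeight (hD : 1 ≤ D) :
    s.mainSum (BoundingSieve.lambdaSquared (selbergWeight s D)) = (selbergSum s D)⁻¹ := by
  have hterm : ∀ l ∈ s.prodPrimes.divisors, (s.selbergTerms l)⁻¹ *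
      (∑ d ∈ s.prodPrimes.divisors, if l ∣ d then s.nu d * selbergWeight s D d else 0) ^ 2 =
        (if l ≤ D then s.selbergTerms l else 0) * (selbergSum s D)⁻¹ ^ 2 := by
    intro l hl
    have hmu : (μ l : ℝ) ^ 2 = 1 := by
      exact_mod_cast moebius_sq_eq_one_of_squarefree
        (BoundingSieve.squarefree_of_mem_divisors_prodPrimes hl)
    rw [sum_nu_mul_selbergWeight, sum_ite_eq]
    simp only [mem_filter, hl, true_and]
    split_ifs
    · have := (selbergTerms_pos_of_mem_divisors hl).ne'
      calc _ = (s.selbergTerms l)⁻¹ * ((μ l : ℝ) ^ 2 * s.selbergTerms l ^ 2 *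
            (selbergSum s D)⁻¹ ^ 2) := by ring
        _ = _ := by rw [hmu]; field_simp
    · ring
  rw [BoundingSieve.mainSum_lambdaSquared_eq_sum_mul_sum_sq, sum_congr rfl hterm, ← sum_mul,
    ← sum_filter, ← selbergSum]
  have := one_pos.trans_le (one_le_selbergSum (s := s) hD)
  field_simp

theorem selbergWeight_eq_zero {d : ℕ} (hd : D < d) : selbergWeight s D d = 0 := by
  have hempty : {m ∈ s.prodPrimes.divisors | d ∣ m ∧ m ≤ D} = ∅ :=
    filter_false_of_mem fun m hm ⟨hdm, hmD⟩ =>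
      ((Nat.le_of_dvd (Nat.pos_of_mem_divisors hm) hdm).trans hmD).not_gt hd
  rw [selbergWeight, hempty, sum_empty, mul_zero, mul_zero, zero_div]

theorem abs_selbergWeight_le (hD : 1 ≤ D) (hnu : ∀ d, d ∣ s.prodPrimes → 1 ≤ d * s.nu d)
    {d : ℕ} (hd : d ∣ s.prodPrimes) : |selbergWeight s D d| ≤ D := by
  rcases lt_or_ge D d with hDd | hdD
  · rw [selbergWeight_eq_zero hDd, abs_zero]
    exact Nat.cast_nonneg D
  have hG : 0 < selbergSum s D := one_pos.trans_le (one_le_selbergSum hD)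
  have hnu₀ := BoundingSieve.nu_pos_of_dvd_prodPrimes hd
  have hsum₀ : 0 ≤ ∑ m ∈ s.prodPrimes.divisors with d ∣ m ∧ m ≤ D, s.selbergTerms m :=
    sum_nonneg fun l hl => (selbergTerms_pos_of_mem_divisors (mem_filter.1 hl).1).le
  have hsum : ∑ m ∈ s.prodPrimes.divisors with d ∣ m ∧ m ≤ D, s.selbergTerms m ≤
      selbergSum s D :=
    sum_le_sum_of_subset_of_nonneg
      (fun m hm => mem_filter.2 ⟨(mem_filter.1 hm).1, (mem_filter.1 hm).2.2⟩)
      fun l hl _ => (selbergTerms_pos_of_mem_divisors (mem_filter.1 hl).1).le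
  have hmu : |(μ d : ℝ)| = 1 := by
    exact_mod_cast abs_moebius_eq_one_of_squarefree (BoundingSieve.squarefree_of_dvd_prodPrimes hd)
  rw [selbergWeight, abs_div, abs_mul, abs_mul, hmu, one_mul, abs_of_nonneg hsum₀,
    abs_of_pos (inv_pos.2 hnu₀), abs_of_pos hG, div_le_iff₀ hG]
  refine mul_le_mul ?_ hsum hsum₀ (Nat.cast_nonneg D)
  rw [inv_le_iff_one_le_mul₀ hnu₀]
  exact (hnu d hd).trans (by gcongr)

theorem lambdaSquared_selbergWeight_eq_zero {d : ℕ} (hd : D ^ 2 < d) :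
    BoundingSieve.lambdaSquared (selbergWeight s D) d = 0 := by
  refine sum_eq_zero fun d₁ hd₁ => sum_eq_zero fun d₂ hd₂ => ?_
  split_ifs with hlcm
  swap
  · rfl
  rcases lt_or_ge D d₁ with h₁ | h₁
  · rw [selbergWeight_eq_zero h₁, zero_mul]
  rcases lt_or_ge D d₂ with h₂ | h₂
  · rw [selbergWeight_eq_zero h₂, mul_zero]
  have hle : d ≤ D ^ 2 := by
    rw [hlcm, sq]
    exact (Nat.lcm_le_mul (Nat.pos_of_mem_divisors hd₁) (Nat.pos_of_mem_divisors hd₂)).trans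
      (Nat.mul_le_mul h₁ h₂)
  omega

theorem abs_lambdaSquared_selbergWeight_le (hD : 1 ≤ D)
    (hnu : ∀ d, d ∣ s.prodPrimes → 1 ≤ d * s.nu d) {d : ℕ} (hd : d ∣ s.prodPrimes) :
    |BoundingSieve.lambdaSquared (selbergWeight s D) d| ≤ (d : ℝ) ^ 2 * (D : ℝ) ^ 2 := by
  have hterm : ∀ d₁ ∈ d.divisors, ∀ d₂ ∈ d.divisors,
      |if d = Nat.lcm d₁ d₂ then selbergWeight s D d₁ * selbergWeight s D d₂ else 0| ≤
        (D : ℝ) ^ 2 := by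
    intro d₁ h₁ d₂ h₂
    split_ifs
    · rw [abs_mul, sq]
      exact mul_le_mul (abs_selbergWeight_le hD hnu ((Nat.dvd_of_mem_divisors h₁).trans hd))
        (abs_selbergWeight_le hD hnu ((Nat.dvd_of_mem_divisors h₂).trans hd)) (abs_nonneg _)
        (Nat.cast_nonneg D)
    · rw [abs_zero]
      positivity
  have hcard : (#d.divisors : ℝ) ≤ d := by exact_mod_cast Nat.card_divisors_le_self d
  calc _ ≤ ∑ _d₁ ∈ d.divisors, ∑ _d₂ ∈ d.divisors, (D : ℝ) ^ 2 :=
        (abs_sum_le_sum_abs _ _).trans (sum_le_sum fun d₁ h₁ =>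
          (abs_sum_le_sum_abs _ _).trans (sum_le_sum fun d₂ h₂ => hterm d₁ h₁ d₂ h₂))
    _ = (#d.divisors : ℝ) ^ 2 * (D : ℝ) ^ 2 := by
        simp only [sum_const, nsmul_eq_mul]
        ring
    _ ≤ _ := by gcongr

theorem errSum_lambdaSquared_selbergWeight_le (hD : 1 ≤ D)
    (hnu : ∀ d, d ∣ s.prodPrimes → 1 ≤ d * s.nu d) (hrem : ∀ d, d ∣ s.prodPrimes → |s.rem d| ≤ d) :
    s.errSum (BoundingSieve.lambdaSquared (selbergWeight s D)) ≤ (D : ℝ) ^ 10 := by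
  have hterm : ∀ d ∈ s.prodPrimes.divisors,
      |BoundingSieve.lambdaSquared (selbergWeight s D) d| * |s.rem d| ≤
        if d ≤ D ^ 2 then (D : ℝ) ^ 8 else 0 := by
    intro d hd
    have hdP := Nat.dvd_of_mem_divisors hd
    split_ifs with hle
    · have hle' : (d : ℝ) ≤ (D : ℝ) ^ 2 := by exact_mod_cast hle
      calc _ ≤ (d : ℝ) ^ 2 * (D : ℝ) ^ 2 * d :=
            mul_le_mul (abs_lambdaSquared_selbergWeight_le hD hnu hdP) (hrem d hdP)
              (abs_nonneg _) (by positivity)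
        _ ≤ ((D : ℝ) ^ 2) ^ 2 * (D : ℝ) ^ 2 * (D : ℝ) ^ 2 := by gcongr
        _ = _ := by ring
    · rw [lambdaSquared_selbergWeight_eq_zero (not_le.1 hle), abs_zero, zero_mul]
  calc _ ≤ ∑ d ∈ s.prodPrimes.divisors, if d ≤ D ^ 2 then (D : ℝ) ^ 8 else 0 := sum_le_sum hterm
    _ = #{d ∈ s.prodPrimes.divisors | d ≤ D ^ 2} * (D : ℝ) ^ 8 := by
        rw [← sum_filter, sum_const, nsmul_eq_mul]
    _ ≤ (D : ℝ) ^ 2 * (D : ℝ) ^ 8 := by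
        gcongr
        exact_mod_cast card_filter_divisors_le s.prodPrimes (D ^ 2)
    _ = _ := by ring

theorem siftedSum_le_div_selbergSum_add (hD : 1 ≤ D)
    (hnu : ∀ d, d ∣ s.prodPrimes → 1 ≤ d * s.nu d) (hrem : ∀ d, d ∣ s.prodPrimes → |s.rem d| ≤ d) :
    s.siftedSum ≤ s.totalMass / selbergSum s D + (D : ℝ) ^ 10 := by
  have hsieve := BoundingSieve.siftedSum_le_mainSum_errSum_of_upperMoebius (s := s) _
    (BoundingSieve.upperMoebius_lambdaSquared _ (selbergWeight_one (s := s) hD))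
  rw [mainSum_lambdaSquared_selbergWeight hD, ← div_eq_mul_inv] at hsieve
  exact hsieve.trans (add_le_add_right (errSum_lambdaSquared_selbergWeight_le hD hnu hrem) _)

end SelbergSieve

section RankinTrick

open ArithmeticFunction

/-- The completely multiplicative function `n ↦ n ^ δ`, as an arithmetic function; `δ ≠ 0` makes it
vanish at `0`. -/
noncomputable def rpowFunction (δ : ℝ) (hδ : δ ≠ 0) : ArithmeticFunction ℝ :=
  ⟨fun n => (n : ℝ) ^ δ, by rw [Nat.cast_zero, Real.zero_rpow hδ]⟩

theorem rpowFunction_apply {δ : ℝ} (hδ : δ ≠ 0) (n : ℕ) : rpowFunction δ hδ n = (n : ℝ) ^ δ := rfl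

theorem isMultiplicative_rpowFunction {δ : ℝ} (hδ : δ ≠ 0) :
    (rpowFunction δ hδ).IsMultiplicative := by
  refine ⟨by rw [rpowFunction_apply, Nat.cast_one, Real.one_rpow], fun {m n} _ => ?_⟩
  simp only [rpowFunction_apply, Nat.cast_mul, Real.mul_rpow (Nat.cast_nonneg m)
    (Nat.cast_nonneg n)]

theorem sum_divisors_gt_mul_rpow_le_prod {f : ArithmeticFunction ℝ} (hf : f.IsMultiplicative)
    {P : ℕ} (hP : Squarefree P) (hf₀ : ∀ l ∈ P.divisors, 0 ≤ f l) {δ : ℝ} (hδ : 0 < δ) (D : ℕ) :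
    (∑ l ∈ P.divisors with ¬ l ≤ D, f l) * (D : ℝ) ^ δ ≤
      ∏ p ∈ P.primeFactors, (1 + f p * (p : ℝ) ^ δ) := by
  calc _ ≤ ∑ l ∈ P.divisors with ¬ l ≤ D, f l * (l : ℝ) ^ δ := by
        rw [sum_mul]
        refine sum_le_sum fun l hl => ?_
        obtain ⟨hl, hDl⟩ := mem_filter.1 hl
        exact mul_le_mul_of_nonneg_left (Real.rpow_le_rpow (Nat.cast_nonneg D)
          (by exact_mod_cast (not_le.1 hDl).le) hδ.le) (hf₀ l hl)
    _ ≤ ∑ l ∈ P.divisors, f l * (l : ℝ) ^ δ :=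
        sum_le_sum_of_subset_of_nonneg (filter_subset _ _) fun l hl _ =>
          mul_nonneg (hf₀ l hl) (Real.rpow_nonneg (Nat.cast_nonneg l) δ)
    _ = _ := by
        have hprod := (hf.pmul
          (isMultiplicative_rpowFunction hδ.ne')).prodPrimeFactors_one_add_of_squarefree hP
        simp only [pmul_apply, rpowFunction_apply] at hprod
        exact hprod.symm

theorem rpow_inv_log_le {x z : ℝ} (hz : 1 < z) (hx : 1 ≤ x) (hxz : x ≤ z) :
    x ^ (Real.log z)⁻¹ ≤ 1 + 2 * (Real.log x / Real.log z) := by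
  have hlz := Real.log_pos hz
  have hratio₀ : 0 ≤ Real.log x / Real.log z := div_nonneg (Real.log_nonneg hx) hlz.le
  have hratio₁ : Real.log x / Real.log z ≤ 1 :=
    (div_le_one hlz).2 (Real.log_le_log (by positivity) hxz)
  have hexp := Real.abs_exp_sub_one_le (x := Real.log x / Real.log z)
    (by rwa [abs_of_nonneg hratio₀])
  rw [abs_of_nonneg hratio₀] at hexp
  rw [Real.rpow_def_of_pos (by positivity), ← div_eq_mul_inv]
  linarith [le_abs_self (Real.exp (Real.log x / Real.log z) - 1)]

variable {s : BoundingSieve}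

theorem nu_mem_Ioo_of_mem_primeFactors {p : ℕ} (hp : p ∈ s.prodPrimes.primeFactors) :
    s.nu p ∈ Set.Ioo 0 1 :=
  ⟨s.nu_pos_of_prime p (Nat.prime_of_mem_primeFactors hp) (Nat.dvd_of_mem_primeFactors hp),
    s.nu_lt_one_of_prime p (Nat.prime_of_mem_primeFactors hp) (Nat.dvd_of_mem_primeFactors hp)⟩

theorem selbergTerms_prime {p : ℕ} (hp : p.Prime) :
    s.selbergTerms p = s.nu p * (1 - s.nu p)⁻¹ := by
  rw [BoundingSieve.selbergTerms_apply, hp.primeFactors, prod_singleton]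

theorem one_add_selbergTerms_prime_mul {p : ℕ} (hp : p ∈ s.prodPrimes.primeFactors) (x : ℝ) :
    1 + s.selbergTerms p * x = (1 - s.nu p)⁻¹ * (1 + s.nu p * (x - 1)) := by
  have : 1 - s.nu p ≠ 0 := (sub_pos.2 (nu_mem_Ioo_of_mem_primeFactors hp).2).ne'
  rw [selbergTerms_prime (Nat.prime_of_mem_primeFactors hp)]
  field_simp
  ring

theorem inv_one_sub_nu_pos {p : ℕ} (hp : p ∈ s.prodPrimes.primeFactors) :
    0 < (1 - s.nu p)⁻¹ :=
  inv_pos.2 (sub_pos.2 (nu_mem_Ioo_of_mem_primeFactors hp).2)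

theorem sum_divisors_selbergTerms :
    ∑ l ∈ s.prodPrimes.divisors, s.selbergTerms l =
      ∏ p ∈ s.prodPrimes.primeFactors, (1 - s.nu p)⁻¹ := by
  rw [← BoundingSieve.selbergTerms_isMultiplicative.prodPrimeFactors_one_add_of_squarefree
    s.prodPrimes_squarefree]
  refine prod_congr rfl fun p hp => ?_
  simpa using one_add_selbergTerms_prime_mul hp 1

theorem one_add_selbergTerms_mul_rpow_le {k p z : ℕ} (hz : 2 ≤ z)
    (hp : p ∈ s.prodPrimes.primeFactors) (hpz : p ≤ z) (hnu : s.nu p ≤ k / p) :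
    1 + s.selbergTerms p * (p : ℝ) ^ (Real.log z)⁻¹ ≤
      (1 - s.nu p)⁻¹ * Real.exp (2 * k / Real.log z * (Real.log p / p)) := by
  have hp₁ : (1 : ℝ) ≤ p := by exact_mod_cast (Nat.prime_of_mem_primeFactors hp).pos
  have hrpow := rpow_inv_log_le (by exact_mod_cast hz) hp₁ (Nat.cast_le.2 hpz)
  have hratio : 0 ≤ 2 * (Real.log p / Real.log z) :=
    mul_nonneg two_pos.le (div_nonneg (Real.log_natCast_nonneg p) (Real.log_natCast_nonneg z))
  rw [one_add_selbergTerms_prime_mul hp]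
  refine mul_le_mul_of_nonneg_left ?_ (inv_one_sub_nu_pos hp).le
  calc 1 + s.nu p * ((p : ℝ) ^ (Real.log z)⁻¹ - 1)
      ≤ 1 + s.nu p * (2 * (Real.log p / Real.log z)) := by
        have := (nu_mem_Ioo_of_mem_primeFactors hp).1.le
        gcongr
        linarith
    _ ≤ 1 + k / p * (2 * (Real.log p / Real.log z)) :=
        add_le_add_right (mul_le_mul_of_nonneg_right hnu hratio) 1
    _ = 2 * k / Real.log z * (Real.log p / p) + 1 := by ring
    _ ≤ _ := Real.add_one_le_exp _

theorem prod_one_add_selbergTerms_mul_rpow_le {z k : ℕ} (hz : 2 ≤ z)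
    (hP : s.prodPrimes.primeFactors ⊆ z.primesLE)
    (hnu : ∀ p ∈ s.prodPrimes.primeFactors, s.nu p ≤ k / p) :
    ∏ p ∈ s.prodPrimes.primeFactors, (1 + s.selbergTerms p * (p : ℝ) ^ (Real.log z)⁻¹) ≤
      (∏ p ∈ s.prodPrimes.primeFactors, (1 - s.nu p)⁻¹) * Real.exp (6 * k) := by
  have hlz : 0 < Real.log z := Real.log_pos (by exact_mod_cast hz)
  have hmertens : ∑ p ∈ s.prodPrimes.primeFactors, Real.log p / p ≤ 3 * Real.log z :=
    calc _ ≤ ∑ p ∈ z.primesLE, Real.log p / p :=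
          sum_le_sum_of_subset_of_nonneg hP fun p _ _ =>
            div_nonneg (Real.log_natCast_nonneg p) (Nat.cast_nonneg p)
      _ ≤ Real.log z + Real.log 4 := sum_log_div_primesLE_le z
      _ ≤ _ := by linarith [log_four_le_two_mul_log hz]
  calc _ ≤ ∏ p ∈ s.prodPrimes.primeFactors,
          (1 - s.nu p)⁻¹ * Real.exp (2 * k / Real.log z * (Real.log p / p)) := by
        refine prod_le_prod (fun p hp => ?_) fun p hp => one_add_selbergTerms_mul_rpow_le hz hp
          (Nat.le_of_mem_primesLE (hP hp)) (hnu p hp)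
        have := BoundingSieve.selbergTerms_pos (Nat.dvd_of_mem_primeFactors hp)
        positivity
    _ = (∏ p ∈ s.prodPrimes.primeFactors, (1 - s.nu p)⁻¹) *
          Real.exp (2 * k / Real.log z * ∑ p ∈ s.prodPrimes.primeFactors, Real.log p / p) := by
        rw [prod_mul_distrib, ← Real.exp_sum, mul_sum]
    _ ≤ _ := by
        refine mul_le_mul_of_nonneg_left (Real.exp_le_exp.2 ?_)
          (prod_nonneg fun p hp => (inv_one_sub_nu_pos hp).le)
        calc _ ≤ 2 * k / Real.log z * (3 * Real.log z) := by gcongr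
          _ = _ := by field_simp; ring

theorem exp_le_rpow_inv_log {z k D : ℕ} (hz : 2 ≤ z) (hD : z ^ k ≤ D) :
    Real.exp k ≤ (D : ℝ) ^ (Real.log z)⁻¹ := by
  have hlz : 0 < Real.log z := Real.log_pos (by exact_mod_cast hz)
  calc Real.exp k = ((z : ℝ) ^ k) ^ (Real.log z)⁻¹ := by
        rw [Real.rpow_def_of_pos (by positivity), Real.log_pow, mul_inv_cancel_right₀ hlz.ne']
    _ ≤ _ := Real.rpow_le_rpow (by positivity) (by exact_mod_cast hD) (inv_pos.2 hlz).le

theorem half_prod_inv_one_sub_nu_le_selbergSum {z k D : ℕ} (hz : 2 ≤ z)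
    (hP : s.prodPrimes.primeFactors ⊆ z.primesLE)
    (hnu : ∀ p ∈ s.prodPrimes.primeFactors, s.nu p ≤ k / p) (hD : z ^ (6 * k + 1) ≤ D) :
    1 / 2 * ∏ p ∈ s.prodPrimes.primeFactors, (1 - s.nu p)⁻¹ ≤ selbergSum s D := by
  set tail := ∑ l ∈ s.prodPrimes.divisors with ¬ l ≤ D, s.selbergTerms l with htail
  set E := ∏ p ∈ s.prodPrimes.primeFactors, (1 - s.nu p)⁻¹ with hE
  have hpos : ∀ l ∈ s.prodPrimes.divisors, 0 ≤ s.selbergTerms l := fun l hl =>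
    (selbergTerms_pos_of_mem_divisors hl).le
  have htail₀ : 0 ≤ tail := sum_nonneg fun l hl => hpos l (mem_filter.1 hl).1
  have hrankin : tail * (2 * Real.exp (6 * k)) ≤ E * Real.exp (6 * k) :=
    calc tail * (2 * Real.exp (6 * k)) ≤ tail * Real.exp (6 * k + 1) := by
          rw [Real.exp_add, mul_comm 2]
          gcongr
          linarith [Real.exp_one_gt_d9]
      _ ≤ tail * (D : ℝ) ^ (Real.log z)⁻¹ :=
          mul_le_mul_of_nonneg_left (by exact_mod_cast exp_le_rpow_inv_log hz hD) htail₀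
      _ ≤ _ := sum_divisors_gt_mul_rpow_le_prod BoundingSieve.selbergTerms_isMultiplicative
          s.prodPrimes_squarefree hpos
          (inv_pos.2 (Real.log_pos (by exact_mod_cast hz))) D
      _ ≤ _ := prod_one_add_selbergTerms_mul_rpow_le hz hP hnu
  have hhalf : tail * 2 ≤ E := by
    rw [← mul_assoc] at hrankin
    exact le_of_mul_le_mul_right hrankin (Real.exp_pos _)
  have hsplit : selbergSum s D + tail = E := by
    rw [selbergSum, htail, hE, ← sum_divisors_selbergTerms]
    exact sum_filter_add_sum_filter_not s.prodPrimes.divisors (· ≤ D) s.selbergTerms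
  linarith

theorem selbergTerms_le_self (hnu : ∀ p ∈ s.prodPrimes.primeFactors, s.nu p ≤ 1 - 1 / p) {l : ℕ}
    (hl : l ∣ s.prodPrimes) : s.selbergTerms l ≤ l := by
  have hprime : ∀ p ∈ l.primeFactors, s.selbergTerms p ≤ p := fun p hp => by
    have hpP := Nat.primeFactors_mono hl BoundingSieve.prodPrimes_ne_zero hp
    have hp₀ : (0 : ℝ) < p := by exact_mod_cast (Nat.prime_of_mem_primeFactors hp).pos
    have hinv : (1 - s.nu p)⁻¹ ≤ p := by
      rw [inv_le_comm₀ (inv_pos.1 (inv_one_sub_nu_pos hpP)) hp₀, ← one_div]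
      linarith [hnu p hpP]
    rw [selbergTerms_prime (Nat.prime_of_mem_primeFactors hp), ← one_mul (p : ℝ)]
    exact mul_le_mul (nu_mem_Ioo_of_mem_primeFactors hpP).2.le hinv (inv_one_sub_nu_pos hpP).le
      zero_le_one
  have hprod := Nat.prod_primeFactors_of_squarefree (BoundingSieve.squarefree_of_dvd_prodPrimes hl)
  calc s.selbergTerms l = ∏ p ∈ l.primeFactors, s.selbergTerms p := by
        rw [← BoundingSieve.selbergTerms_isMultiplicative.map_prod_of_subset_primeFactors _ _
          subset_rfl, hprod]
    _ ≤ ∏ p ∈ l.primeFactors, (p : ℝ) := prod_le_prod (fun p hp =>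
        (BoundingSieve.selbergTerms_pos ((Nat.dvd_of_mem_primeFactors hp).trans hl)).le) hprime
    _ = l := by rw [← Nat.cast_prod, hprod]

theorem selbergSum_le_sq {D : ℕ}
    (hnu : ∀ p ∈ s.prodPrimes.primeFactors, s.nu p ≤ 1 - 1 / p) :
    selbergSum s D ≤ (D : ℝ) ^ 2 := by
  calc selbergSum s D ≤ ∑ l ∈ s.prodPrimes.divisors with l ≤ D, (D : ℝ) :=
        sum_le_sum fun l hl =>
          (selbergTerms_le_self hnu (Nat.dvd_of_mem_divisors (mem_filter.1 hl).1)).trans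
            (by exact_mod_cast (mem_filter.1 hl).2)
    _ = #{l ∈ s.prodPrimes.divisors | l ≤ D} * (D : ℝ) := by rw [sum_const, nsmul_eq_mul]
    _ ≤ D * D := by
        gcongr
        exact card_filter_divisors_le s.prodPrimes D
    _ = _ := (sq _).symm

end RankinTrick

section CongruencePreserving

/-- The property that `a ≡ b [MOD d]` implies `f a ≡ f b [MOD d]`, shared by all polynomial
functions; it is all the sieve needs to know about the sequence `f`. -/
def CongruencePreserving (f : ℕ → ℕ) : Prop :=
  ∀ ⦃a b d : ℕ⦄, a ≡ b [MOD d] → f a ≡ f b [MOD d]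

/-- The number of solutions of `f r ≡ 0` modulo `d`, for congruence-preserving `f`. -/
def rootCount (f : ℕ → ℕ) (d : ℕ) : ℕ := #{r ∈ range d | d ∣ f r}

variable {f : ℕ → ℕ}

theorem CongruencePreserving.dvd_iff (hf : CongruencePreserving f) {a b d : ℕ}
    (h : a ≡ b [MOD d]) : d ∣ f a ↔ d ∣ f b :=
  (hf h).dvd_iff dvd_rfl

theorem CongruencePreserving.periodic_dvd (hf : CongruencePreserving f) (d : ℕ) :
    Function.Periodic (fun n => d ∣ f n) d := fun n =>
  propext (hf.dvd_iff (Nat.add_mod_right n d))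

theorem rootCount_le (f : ℕ → ℕ) (d : ℕ) : rootCount f d ≤ d :=
  (card_filter_le _ _).trans (card_range d).le

theorem rootCount_one (f : ℕ → ℕ) : rootCount f 1 = 1 := by simp [rootCount]

theorem CongruencePreserving.rootCount_mul (hf : CongruencePreserving f) {m n : ℕ}
    (hmn : m.Coprime n) : rootCount f (m * n) = rootCount f m * rootCount f n := by
  rcases m.eq_zero_or_pos with rfl | hm
  · simp [rootCount]
  rcases n.eq_zero_or_pos with rfl | hn
  · simp [rootCount]
  rw [rootCount, rootCount, rootCount, ← card_product]
  refine card_nbij (fun r => (r % m, r % n)) ?_ ?_ ?_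
  · intro r hr
    obtain ⟨-, hroot⟩ := mem_filter.1 hr
    exact mem_product.2
      ⟨mem_filter.2 ⟨mem_range.2 (Nat.mod_lt r hm),
        (hf.dvd_iff (Nat.mod_modEq r m)).2 ((dvd_mul_right m n).trans hroot)⟩,
      mem_filter.2 ⟨mem_range.2 (Nat.mod_lt r hn),
        (hf.dvd_iff (Nat.mod_modEq r n)).2 ((dvd_mul_left n m).trans hroot)⟩⟩
  · intro r hr r' hr' heq
    exact ((Nat.modEq_and_modEq_iff_modEq_mul hmn).1 (Prod.mk.inj heq)).eq_of_lt_of_lt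
      (mem_range.1 (mem_filter.1 hr).1) (mem_range.1 (mem_filter.1 hr').1)
  · intro ⟨a, b⟩ hab
    obtain ⟨ha, hb⟩ := mem_product.1 (mem_coe.1 hab)
    obtain ⟨ham, hfa⟩ := mem_filter.1 ha
    obtain ⟨hbn, hfb⟩ := mem_filter.1 hb
    obtain ⟨hra, hrb⟩ := (Nat.chineseRemainder hmn a b).2
    refine ⟨Nat.chineseRemainder hmn a b, mem_coe.2 (mem_filter.2
      ⟨mem_range.2 (Nat.chineseRemainder_lt_mul hmn a b hm.ne' hn.ne'),
        hmn.mul_dvd_of_dvd_of_dvd ((hf.dvd_iff hra).2 hfa) ((hf.dvd_iff hrb).2 hfb)⟩), ?_⟩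
    exact Prod.ext (Eq.trans hra (Nat.mod_eq_of_lt (mem_range.1 ham)))
      (Eq.trans hrb (Nat.mod_eq_of_lt (mem_range.1 hbn)))

variable {d : ℕ} {P : ℕ → Prop} [DecidablePred P]

theorem card_filter_Ico_mul_of_periodic (hP : Function.Periodic P d) (a q : ℕ) :
    #{n ∈ Ico a (a + q * d) | P n} = q * d.count P := by
  induction q with
  | zero => simp
  | succ q ih =>
    have hsplit : Ico a (a + (q + 1) * d) =
        Ico a (a + q * d) ∪ Ico (a + q * d) (a + q * d + d) := by
      rw [Ico_union_Ico_eq_Ico (by omega) (by omega), add_one_mul, add_assoc]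
    rw [hsplit, filter_union, card_union_of_disjoint
      (disjoint_filter_filter (Ico_disjoint_Ico_consecutive _ _ _)), ih,
      Nat.filter_Ico_card_eq_of_periodic _ _ _ hP, add_one_mul]

theorem abs_card_filter_Ico_sub_le_of_periodic (hP : Function.Periodic P d) (hd : 0 < d)
    (a N : ℕ) : |(#{n ∈ Ico a (a + N) | P n} : ℝ) - d.count P / d * N| ≤ d.count P := by
  have hqN : N / d * d ≤ N := Nat.div_mul_le_self N d
  have hNq : N ≤ (N / d + 1) * d := by
    rw [mul_comm]
    exact (Nat.lt_mul_div_succ N hd).le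
  have hlower : ((N / d : ℕ) : ℝ) * d.count P ≤ #{n ∈ Ico a (a + N) | P n} := by
    norm_cast
    rw [← card_filter_Ico_mul_of_periodic hP a]
    exact card_le_card (filter_subset_filter _ (Ico_subset_Ico_right (by omega)))
  have hupper : (#{n ∈ Ico a (a + N) | P n} : ℝ) ≤ ((N / d : ℕ) + 1) * d.count P := by
    norm_cast
    rw [← card_filter_Ico_mul_of_periodic hP a]
    exact card_le_card (filter_subset_filter _ (Ico_subset_Ico_right (by omega)))
  have hfloor : ((N / d : ℕ) : ℝ) ≤ N / d := Nat.cast_div_le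
  have hceil : (N : ℝ) / d ≤ (N / d : ℕ) + 1 := by
    rw [div_le_iff₀ (by exact_mod_cast hd)]
    exact_mod_cast hNq
  have hcount₀ : (0 : ℝ) ≤ d.count P := Nat.cast_nonneg _
  have hfloor' := mul_le_mul_of_nonneg_right hfloor hcount₀
  have hceil' := mul_le_mul_of_nonneg_right hceil hcount₀
  rw [div_mul_comm, abs_le]
  constructor <;> linarith

theorem CongruencePreserving.abs_card_filter_dvd_sub_le (hf : CongruencePreserving f)
    (hd : 0 < d) (a N : ℕ) :
    |(#{n ∈ Ico a (a + N) | d ∣ f n} : ℝ) - rootCount f d / d * N| ≤ d := by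
  have hcount : d.count (fun n => d ∣ f n) = rootCount f d := by
    rw [Nat.count_eq_card_filter_range, rootCount]
  rw [← hcount]
  refine (abs_card_filter_Ico_sub_le_of_periodic (hf.periodic_dvd d) hd a N).trans ?_
  rw [hcount]
  exact_mod_cast rootCount_le f d

end CongruencePreserving

section RootSieve

/-- The density `d ↦ ρ(d) / d` of the `n` with `d ∣ f n`, as an arithmetic function. -/
noncomputable def rootDensity (f : ℕ → ℕ) : ArithmeticFunction ℝ :=
  ⟨fun d => rootCount f d / d, by simp⟩

theorem rootDensity_apply (f : ℕ → ℕ) (d : ℕ) : rootDensity f d = (rootCount f d : ℝ) / d := rfl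

variable {f : ℕ → ℕ}

theorem CongruencePreserving.isMultiplicative_rootDensity (hf : CongruencePreserving f) :
    (rootDensity f).IsMultiplicative := by
  refine ⟨by simp [rootDensity_apply, rootCount_one], fun {m n} hmn => ?_⟩
  simp only [rootDensity_apply, hf.rootCount_mul hmn, Nat.cast_mul, mul_div_mul_comm]

theorem sum_image_ite_card_fiber (s : Finset ℕ) (f : ℕ → ℕ) (P : ℕ → Prop) [DecidablePred P] :
    ∑ m ∈ s.image f, (if P m then (#{n ∈ s | f n = m} : ℝ) else 0) = #{n ∈ s | P (f n)} := by
  have hcomp := sum_comp (s := s) (fun m => if P m then (1 : ℝ) else 0) f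
  simp only [nsmul_eq_mul, mul_ite, mul_one, mul_zero] at hcomp
  rw [← hcomp, sum_boole]

variable {P z k D : ℕ}

/-- The problem of sifting the values `f n`, `a ≤ n < a + N`, counted with multiplicity, by the
primes dividing `P`. -/
noncomputable def rootSieve (hf : CongruencePreserving f) (hP : Squarefree P)
    (hρ : ∀ p ∈ P.primeFactors, rootCount f p ∈ Set.Ioo 0 p) (a N : ℕ) : BoundingSieve where
  support := (Ico a (a + N)).image f
  prodPrimes := P
  prodPrimes_squarefree := hP
  weights m := #{n ∈ Ico a (a + N) | f n = m}
  weights_nonneg _ := Nat.cast_nonneg _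
  totalMass := N
  nu := rootDensity f
  nu_mult := hf.isMultiplicative_rootDensity
  nu_pos_of_prime p hp hpP := div_pos
    (by exact_mod_cast (hρ p (Nat.mem_primeFactors.2 ⟨hp, hpP, hP.ne_zero⟩)).1)
    (by exact_mod_cast hp.pos)
  nu_lt_one_of_prime p hp hpP := by
    rw [rootDensity_apply, div_lt_one (by exact_mod_cast hp.pos)]
    exact_mod_cast (hρ p (Nat.mem_primeFactors.2 ⟨hp, hpP, hP.ne_zero⟩)).2

variable (hf : CongruencePreserving f) (hP : Squarefree P)
  (hρ : ∀ p ∈ P.primeFactors, rootCount f p ∈ Set.Ioo 0 p) (a N : ℕ)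

theorem siftedSum_rootSieve :
    (rootSieve hf hP hρ a N).siftedSum = #{n ∈ Ico a (a + N) | P.Coprime (f n)} :=
  sum_image_ite_card_fiber _ f _

theorem abs_rem_rootSieve_le {d : ℕ} (hd : d ∣ P) : |(rootSieve hf hP hρ a N).rem d| ≤ d := by
  have hmult : (rootSieve hf hP hρ a N).multSum d = #{n ∈ Ico a (a + N) | d ∣ f n} :=
    sum_image_ite_card_fiber _ f _
  rw [BoundingSieve.rem, hmult]
  exact hf.abs_card_filter_dvd_sub_le (Nat.pos_of_dvd_of_pos hd hP.ne_zero.bot_lt) a N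

theorem one_le_mul_nu_rootSieve {d : ℕ} (hd : d ∣ P) :
    1 ≤ d * (rootSieve hf hP hρ a N).nu d := by
  have hd₀ : (0 : ℝ) < d := by exact_mod_cast Nat.pos_of_dvd_of_pos hd hP.ne_zero.bot_lt
  have hpos : (0 : ℝ) < d * (rootSieve hf hP hρ a N).nu d :=
    mul_pos hd₀ (BoundingSieve.nu_pos_of_dvd_prodPrimes hd)
  have hnu : d * (rootSieve hf hP hρ a N).nu d = rootCount f d := mul_div_cancel₀ _ hd₀.ne'
  rw [hnu] at hpos ⊢
  exact_mod_cast hpos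

theorem half_inv_prod_le_selbergSum_rootSieve (hz : 2 ≤ z) (hPz : P.primeFactors ⊆ z.primesLE)
    (hk : ∀ p ∈ P.primeFactors, rootCount f p ≤ k) (hD : z ^ (6 * k + 1) ≤ D) :
    1 / 2 * (∏ p ∈ P.primeFactors, (1 - (rootCount f p : ℝ) / p))⁻¹ ≤
      selbergSum (rootSieve hf hP hρ a N) D := by
  rw [← prod_inv_distrib]
  exact half_prod_inv_one_sub_nu_le_selbergSum (s := rootSieve hf hP hρ a N) hz hPz
    (fun p hp => div_le_div_of_nonneg_right (by exact_mod_cast hk p hp) (Nat.cast_nonneg p)) hD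

theorem selbergSum_rootSieve_le_sq : selbergSum (rootSieve hf hP hρ a N) D ≤ (D : ℝ) ^ 2 := by
  refine selbergSum_le_sq fun p hp => ?_
  have hp₀ : (0 : ℝ) < p := by exact_mod_cast (Nat.prime_of_mem_primeFactors hp).pos
  change (rootCount f p : ℝ) / p ≤ 1 - 1 / p
  rw [le_sub_iff_add_le, ← add_div, div_le_one hp₀]
  exact_mod_cast (hρ p hp).2

include hf hP hρ in
theorem card_filter_coprime_le (hz : 2 ≤ z) (hPz : P.primeFactors ⊆ z.primesLE)
    (hk : ∀ p ∈ P.primeFactors, rootCount f p ≤ k) (hD : z ^ (6 * k + 1) ≤ D) :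
    (#{n ∈ Ico a (a + N) | P.Coprime (f n)} : ℝ) ≤
      2 * (N + (D : ℝ) ^ 12) * ∏ p ∈ P.primeFactors, (1 - (rootCount f p : ℝ) / p) := by
  have hD₁ : 1 ≤ D := (Nat.one_le_pow _ _ (by omega)).trans hD
  have hV : 0 < ∏ p ∈ P.primeFactors, (1 - (rootCount f p : ℝ) / p) := prod_pos fun p hp => by
    rw [sub_pos, div_lt_one (by exact_mod_cast (Nat.prime_of_mem_primeFactors hp).pos)]
    exact_mod_cast (hρ p hp).2
  have hlower := half_inv_prod_le_selbergSum_rootSieve hf hP hρ a N hz hPz hk hD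
  have hupper := selbergSum_rootSieve_le_sq hf hP hρ a N (D := D)
  have hsieve := siftedSum_le_div_selbergSum_add hD₁
    (fun d hd => one_le_mul_nu_rootSieve hf hP hρ a N hd)
    (fun d hd => abs_rem_rootSieve_le hf hP hρ a N hd)
  rw [siftedSum_rootSieve, show (rootSieve hf hP hρ a N).totalMass = N from rfl] at hsieve
  set V := ∏ p ∈ P.primeFactors, (1 - (rootCount f p : ℝ) / p)
  set G := selbergSum (rootSieve hf hP hρ a N) D
  have hinv : G⁻¹ ≤ 2 * V := by
    rw [inv_le_comm₀ (hlower.trans_lt' (by positivity)) (by positivity), mul_inv]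
    linarith
  have hone : 1 ≤ 2 * V * (D : ℝ) ^ 2 :=
    calc 1 = 2 * V * (1 / 2 * V⁻¹) := by field_simp
      _ ≤ _ := by gcongr; exact hlower.trans hupper
  calc (#{n ∈ Ico a (a + N) | P.Coprime (f n)} : ℝ) ≤ N / G + (D : ℝ) ^ 10 := hsieve
    _ = N * G⁻¹ + (D : ℝ) ^ 10 * 1 := by ring
    _ ≤ N * (2 * V) + (D : ℝ) ^ 10 * (2 * V * (D : ℝ) ^ 2) := by gcongr
    _ = _ := by ring

end RootSieve

section PrimeTuples

/-- The polynomial `∏_{h ∈ H} (n + h)`. -/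
def shiftProd (H : Finset ℕ) (n : ℕ) : ℕ := ∏ h ∈ H, (n + h)

theorem congruencePreserving_shiftProd (H : Finset ℕ) : CongruencePreserving (shiftProd H) := by
  intro a b d hab
  exact Nat.ModEq.prod fun h _ => hab.add_right h

theorem residueCount_pos {H : Finset ℕ} (hH : H.Nonempty) (p : ℕ) : 0 < residueCount H p :=
  card_pos.2 (hH.image _)

theorem residueCount_le_card (H : Finset ℕ) (p : ℕ) : residueCount H p ≤ #H := card_image_le

theorem filter_dvd_shiftProd (H : Finset ℕ) {p : ℕ} (hp : p.Prime) :
    {r ∈ range p | p ∣ shiftProd H r} = H.image fun h : ℕ => (-(h : ZMod p)).val := by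
  have := Fact.mk hp
  ext r
  simp only [mem_filter, mem_range, mem_image]
  constructor
  · rintro ⟨hr, hroot⟩
    obtain ⟨h, hh, hdvd⟩ := (hp.prime.dvd_finsetProd_iff _).1 hroot
    have hsum : (r : ZMod p) + h = 0 := by exact_mod_cast (ZMod.natCast_eq_zero_iff _ p).2 hdvd
    exact ⟨h, hh, by rw [← eq_neg_of_add_eq_zero_left hsum, ZMod.val_cast_of_lt hr]⟩
  · rintro ⟨h, hh, rfl⟩
    refine ⟨ZMod.val_lt _, dvd_trans ?_ (dvd_prod_of_mem _ hh)⟩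
    rw [← ZMod.natCast_eq_zero_iff]
    simp

theorem rootCount_shiftProd (H : Finset ℕ) {p : ℕ} (hp : p.Prime) :
    rootCount (shiftProd H) p = residueCount H p := by
  have := Fact.mk hp
  calc rootCount (shiftProd H) p
      = #((H.image (Nat.cast : ℕ → ZMod p)).image fun x => (-x).val) := by
        rw [rootCount, filter_dvd_shiftProd H hp, image_image]
        rfl
    _ = #(H.image (Nat.cast : ℕ → ZMod p)) :=
        card_image_of_injective _ ((ZMod.val_injective p).comp neg_injective)
    _ = #((H.image (Nat.cast : ℕ → ZMod p)).image ZMod.val) :=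
        (card_image_of_injective _ (ZMod.val_injective p)).symm
    _ = residueCount H p := by
        simp only [residueCount, image_image, Function.comp_def, ZMod.val_natCast]

theorem residueCount_le (H : Finset ℕ) {p : ℕ} (hp : p.Prime) : residueCount H p ≤ p :=
  rootCount_shiftProd H hp ▸ rootCount_le (shiftProd H) p

theorem coprime_primorial_shiftProd {H : Finset ℕ} {n z : ℕ} (hzn : z < n)
    (hprime : ∀ h ∈ H, (n + h).Prime) : (primorial z).Coprime (shiftProd H n) := by
  refine Nat.coprime_prod_right_iff.2 fun h hh => Nat.coprime_of_dvd fun p hp hpz hpn => ?_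
  have hle : p ≤ z := hp.dvd_primorial_iff.1 hpz
  have heq : p = n + h := (Nat.prime_dvd_prime_iff_eq hp (hprime h hh)).1 hpn
  omega

theorem card_prime_tuples_le {H : Finset ℕ} (hH : H.Nonempty) {a N z D : ℕ} (hz : 2 ≤ z)
    (hza : z < a) (hD : z ^ (6 * #H + 1) ≤ D)
    (hadm : ∀ p ∈ z.primesLE, residueCount H p < p) :
    (#{n ∈ Ico a (a + N) | ∀ h ∈ H, (n + h).Prime} : ℝ) ≤
      2 * (N + (D : ℝ) ^ 12) * ∏ p ∈ z.primesLE, (1 - (residueCount H p : ℝ) / p) := by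
  have hroot : ∀ p ∈ z.primesLE, rootCount (shiftProd H) p = residueCount H p := fun p hp =>
    rootCount_shiftProd H (Nat.prime_of_mem_primesLE hp)
  have hsieve := card_filter_coprime_le (congruencePreserving_shiftProd H)
    (squarefree_primorial z) (k := #H) (D := D) (z := z) (a := a) (N := N)
  simp only [primeFactors_primorial] at hsieve
  calc (#{n ∈ Ico a (a + N) | ∀ h ∈ H, (n + h).Prime} : ℝ)
      ≤ #{n ∈ Ico a (a + N) | (primorial z).Coprime (shiftProd H n)} := by
        refine Nat.cast_le.2 (card_le_card fun n hn => ?_)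
        obtain ⟨hmem, hprime⟩ := mem_filter.1 hn
        exact mem_filter.2
          ⟨hmem, coprime_primorial_shiftProd (hza.trans_le (mem_Ico.1 hmem).1) hprime⟩
    _ ≤ _ := hsieve (fun p hp => hroot p hp ▸ ⟨residueCount_pos hH p, hadm p hp⟩) hz subset_rfl
        (fun p hp => hroot p hp ▸ residueCount_le_card H p) hD
    _ = _ := by
        congr 1
        exact prod_congr rfl fun p hp => by rw [hroot p hp]

end PrimeTuples

section SingularSeries

variable {H : Finset ℕ} {p : ℕ}

theorem residueCount_div_le_one (H : Finset ℕ) (hp : p.Prime) : (residueCount H p : ℝ) / p ≤ 1 :=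
  div_le_one_of_le₀ (Nat.cast_le.2 (residueCount_le H hp)) p.cast_nonneg

theorem one_le_inv_one_sub_one_div_prime (hp : p.Prime) : 1 ≤ (1 - 1 / (p : ℝ))⁻¹ :=
  (one_le_inv₀ (one_sub_one_div_prime_pos hp)).2 (sub_le_self _ (by positivity))

theorem singularFactor_nonneg (H : Finset ℕ) (hp : p.Prime) : 0 ≤ singularFactor H p :=
  mul_nonneg (sub_nonneg.2 (residueCount_div_le_one H hp))
    (inv_nonneg.2 (pow_nonneg (one_sub_one_div_prime_pos hp).le _))

theorem hasProd_singularSeries (H : Finset ℕ) :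
    HasProd (fun p : Nat.Primes => singularFactor H p) (singularSeries H) :=
  (multipliable_singularFactor H).hasProd

theorem singularSeries_nonneg (H : Finset ℕ) : 0 ≤ singularSeries H :=
  ge_of_tendsto' (hasProd_singularSeries H) fun _ =>
    prod_nonneg fun p _ => singularFactor_nonneg H p.2

theorem one_sub_le_singularFactor (H : Finset ℕ) (hp : p.Prime) :
    1 - 2 ^ #H * (#H : ℝ) ^ 2 * ((p : ℝ) ^ 2)⁻¹ ≤ singularFactor H p := by
  have hx₂ : 1 / (p : ℝ) ≤ 1 / 2 :=
    one_div_le_one_div_of_le two_pos (Nat.ofNat_le_cast.2 hp.two_le)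
  have hx₀ : 0 ≤ 1 / (p : ℝ) := by positivity
  have hν : (residueCount H p : ℝ) ≤ #H := Nat.cast_le.2 (residueCount_le_card H p)
  rw [singularFactor, div_eq_mul_one_div, ← inv_pow, ← one_div]
  generalize 1 / (p : ℝ) = x at hx₂ hx₀
  generalize #H = k at hν
  have hpos : 0 < (1 - x) ^ k := pow_pos (by linarith) k
  have hinv : ((1 - x) ^ k)⁻¹ ≤ 2 ^ k := by
    rw [← inv_pow]
    refine pow_le_pow_left₀ (inv_nonneg.2 (by linarith)) ?_ k
    rw [inv_le_comm₀ (by linarith) two_pos]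
    linarith
  have hnum : (1 - x) ^ k - (k : ℝ) ^ 2 * x ^ 2 ≤ 1 - residueCount H p * x := by
    nlinarith [one_sub_pow_le k x hx₀ (by linarith)]
  calc 1 - (2 : ℝ) ^ k * (k : ℝ) ^ 2 * x ^ 2 = 1 - (k : ℝ) ^ 2 * x ^ 2 * 2 ^ k := by ring
    _ ≤ 1 - (k : ℝ) ^ 2 * x ^ 2 * ((1 - x) ^ k)⁻¹ := by gcongr
    _ = ((1 - x) ^ k - (k : ℝ) ^ 2 * x ^ 2) * ((1 - x) ^ k)⁻¹ := by
        rw [sub_mul, mul_inv_cancel₀ hpos.ne']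
    _ ≤ (1 - residueCount H p * x) * ((1 - x) ^ k)⁻¹ := by gcongr

theorem one_sub_sum_le_prod {ι : Type*} {s : Finset ι} {f a : ι → ℝ} (ha : ∀ i ∈ s, 0 ≤ a i)
    (hf₀ : ∀ i ∈ s, 0 ≤ f i) (hf : ∀ i ∈ s, 1 - a i ≤ f i) : 1 - ∑ i ∈ s, a i ≤ ∏ i ∈ s, f i := by
  classical
  induction s using Finset.induction_on with
  | empty => simp
  | insert i s hi ih =>
    simp only [forall_mem_insert] at ha hf₀ hf
    rw [sum_insert hi, prod_insert hi]
    have hprod := ih ha.2 hf₀.2 hf.2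
    have hsum : 0 ≤ ∑ j ∈ s, a j := sum_nonneg ha.2
    have hprod₀ : 0 ≤ ∏ j ∈ s, f j := prod_nonneg hf₀.2
    rcases le_total 0 (1 - ∑ j ∈ s, a j) with h | h
    · calc 1 - (a i + ∑ j ∈ s, a j) ≤ (1 - a i) * (1 - ∑ j ∈ s, a j) := by
            linarith [mul_nonneg ha.1 hsum]
        _ ≤ f i * ∏ j ∈ s, f j := mul_le_mul hf.1 hprod h hf₀.1
    · linarith [ha.1, mul_nonneg hf₀.1 hprod₀]

theorem sum_inv_sq_le_of_forall_lt {s : Finset ℕ} {z : ℕ} (hs : ∀ n ∈ s, z < n) :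
    ∑ n ∈ s, ((n : ℝ) ^ 2)⁻¹ ≤ 2 / (z + 1) :=
  calc ∑ n ∈ s, ((n : ℝ) ^ 2)⁻¹ ≤ ∑ n ∈ Ioo z (s.sup id + 1), ((n : ℝ) ^ 2)⁻¹ :=
        sum_le_sum_of_subset_of_nonneg (fun n hn => mem_Ioo.2
          ⟨hs n hn, Nat.lt_succ_of_le (le_sup (f := id) hn)⟩) fun _ _ _ => by positivity
    _ ≤ 2 / (z + 1) := sum_Ioo_inv_sq_le z _

theorem half_le_prod_singularFactor {z : ℕ} (hz : 2 ^ (#H + 2) * #H ^ 2 ≤ z) {s : Finset ℕ}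
    (hs : ∀ p ∈ s, p.Prime) (hzs : ∀ p ∈ s, z < p) :
    (1 / 2 : ℝ) ≤ ∏ p ∈ s, singularFactor H p := by
  have hz' : 2 ^ (#H + 2) * (#H : ℝ) ^ 2 ≤ z := by exact_mod_cast hz
  have hsum : 2 ^ #H * (#H : ℝ) ^ 2 * ∑ p ∈ s, ((p : ℝ) ^ 2)⁻¹ ≤ 1 / 2 :=
    calc _ ≤ 2 ^ #H * (#H : ℝ) ^ 2 * (2 / (z + 1)) := by
          gcongr
          exact sum_inv_sq_le_of_forall_lt hzs
      _ ≤ 1 / 2 := by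
          rw [← mul_div_assoc, div_le_iff₀ (by positivity)]
          rw [pow_add] at hz'
          linarith
  rw [mul_sum] at hsum
  linarith [one_sub_sum_le_prod (f := singularFactor H) (fun p _ => by positivity)
    (fun p hp => singularFactor_nonneg H (hs p hp)) fun p hp =>
      one_sub_le_singularFactor H (hs p hp)]

theorem prod_primes_eq_prod_image (T : Finset Nat.Primes) (f : ℕ → ℝ) :
    ∏ p ∈ T, f p = ∏ p ∈ T.image ((↑) : Nat.Primes → ℕ), f p :=
  (prod_image Nat.Primes.coe_nat_injective.injOn).symm

theorem half_prod_singularFactor_le_singularSeries {z : ℕ} (hz : 2 ^ (#H + 2) * #H ^ 2 ≤ z) :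
    (1 / 2 : ℝ) * ∏ p ∈ z.primesLE, singularFactor H p ≤ singularSeries H := by
  set T₀ : Finset Nat.Primes := z.primesLE.subtype Nat.Prime
  have hprod : ∏ p ∈ z.primesLE, singularFactor H p = ∏ p ∈ T₀, singularFactor H p :=
    (prod_subtype_of_mem (singularFactor H) fun _ => Nat.prime_of_mem_primesLE).symm
  rw [hprod]
  refine ge_of_tendsto (hasProd_singularSeries H) ?_
  filter_upwards [Filter.eventually_ge_atTop T₀] with T hT
  rw [← prod_sdiff hT, prod_primes_eq_prod_image (T \ T₀)]
  refine mul_le_mul_of_nonneg_right (half_le_prod_singularFactor hz ?_ ?_)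
    (prod_nonneg fun p _ => singularFactor_nonneg H p.2)
  · exact forall_mem_image.2 fun p _ => p.2
  · refine forall_mem_image.2 fun p hp => lt_of_not_ge fun hle => (mem_sdiff.1 hp).2 ?_
    exact mem_subtype.2 (Nat.mem_primesLE.2 ⟨hle, p.2⟩)

end SingularSeries

section DifferenceProduct

variable {H : Finset ℕ} {p : ℕ}

/-- The product of the positive differences of elements of `H`: outside its prime divisors, the
elements of `H` occupy distinct residue classes. -/
def differenceProduct (H : Finset ℕ) : ℕ := ∏ x ∈ H ×ˢ H with x.1 < x.2, (x.2 - x.1)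

theorem differenceProduct_pos (H : Finset ℕ) : 0 < differenceProduct H :=
  prod_pos fun _ hx => Nat.sub_pos_of_lt (mem_filter.1 hx).2

theorem differenceProduct_le_pow {B : ℝ} (hB : 1 ≤ B) (hH : ∀ h ∈ H, (h : ℝ) ≤ B) :
    (differenceProduct H : ℝ) ≤ B ^ #H ^ 2 := by
  rw [differenceProduct, Nat.cast_prod]
  calc ∏ x ∈ H ×ˢ H with x.1 < x.2, ((x.2 - x.1 : ℕ) : ℝ)
      ≤ ∏ _x ∈ H ×ˢ H with _x.1 < _x.2, B :=
        prod_le_prod (fun _ _ => Nat.cast_nonneg _) fun x hx =>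
          (Nat.cast_le.2 (Nat.sub_le _ _)).trans (hH x.2 (mem_product.1 (mem_filter.1 hx).1).2)
    _ = B ^ #{x ∈ H ×ˢ H | x.1 < x.2} := prod_const B
    _ ≤ B ^ #H ^ 2 := pow_le_pow_right₀ hB
        ((card_filter_le _ _).trans_eq (by rw [card_product, sq]))

theorem residueCount_eq_card_of_not_dvd (hp : ¬ p ∣ differenceProduct H) :
    residueCount H p = #H := by
  have not_lt_of_mod_eq : ∀ a ∈ H, ∀ b ∈ H, a % p = b % p → ¬ a < b := fun a ha b hb hab hlt =>
    hp (((Nat.modEq_iff_dvd' hlt.le).1 hab).trans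
      (dvd_prod_of_mem (fun x : ℕ × ℕ => x.2 - x.1)
        (mem_filter.2 ⟨mem_product.2 ⟨ha, hb⟩, hlt⟩ : (a, b) ∈ {x ∈ H ×ˢ H | x.1 < x.2})))
  exact card_image_of_injOn fun a ha b hb hab => le_antisymm
    (not_lt.1 (not_lt_of_mod_eq b hb a ha hab.symm)) (not_lt.1 (not_lt_of_mod_eq a ha b hb hab))

theorem singularFactor_le_one_of_not_dvd (hp : p.Prime) (hd : ¬ p ∣ differenceProduct H) :
    singularFactor H p ≤ 1 := by
  have h₀ := one_sub_one_div_prime_pos hp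
  rw [singularFactor, residueCount_eq_card_of_not_dvd hd, ← div_eq_mul_inv,
    div_le_one (pow_pos h₀ _)]
  calc 1 - (#H : ℝ) / p = 1 + #H * -(1 / (p : ℝ)) := by ring
    _ ≤ (1 + -(1 / (p : ℝ))) ^ #H := one_add_mul_le_pow (by linarith) #H
    _ = (1 - 1 / (p : ℝ)) ^ #H := by rw [← sub_eq_add_neg]

theorem singularFactor_le_pow (H : Finset ℕ) (hp : p.Prime) :
    singularFactor H p ≤ ((1 - 1 / (p : ℝ))⁻¹) ^ #H := by
  rw [singularFactor, inv_pow]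
  exact mul_le_of_le_one_left (inv_nonneg.2 (pow_pos (one_sub_one_div_prime_pos hp) _).le)
    (sub_le_self _ (by positivity))

theorem singularSeries_le_prod_primeFactors (H : Finset ℕ) :
    singularSeries H ≤
      (∏ p ∈ (differenceProduct H).primeFactors, (1 - 1 / (p : ℝ))⁻¹) ^ #H := by
  refine le_of_tendsto' (hasProd_singularSeries H) fun T => ?_
  rw [prod_primes_eq_prod_image, ← prod_pow]
  set S := T.image ((↑) : Nat.Primes → ℕ)
  have hS : ∀ p ∈ S, p.Prime := forall_mem_image.2 fun p _ => p.2
  calc ∏ p ∈ S, singularFactor H p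
      ≤ ∏ p ∈ S, if p ∣ differenceProduct H then ((1 - 1 / (p : ℝ))⁻¹) ^ #H else 1 := by
        refine prod_le_prod (fun p hp => singularFactor_nonneg H (hS p hp)) fun p hp => ?_
        split_ifs with hd
        · exact singularFactor_le_pow H (hS p hp)
        · exact singularFactor_le_one_of_not_dvd (hS p hp) hd
    _ = ∏ p ∈ S with p ∣ differenceProduct H, ((1 - 1 / (p : ℝ))⁻¹) ^ #H := (prod_filter _ _).symm
    _ ≤ ∏ p ∈ (differenceProduct H).primeFactors, ((1 - 1 / (p : ℝ))⁻¹) ^ #H := by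
        refine prod_le_prod_of_subset_of_one_le (fun p hp => ?_) (fun p hp => ?_) fun p hp _ => ?_
        · obtain ⟨hpS, hd⟩ := mem_filter.1 hp
          exact Nat.mem_primeFactors.2 ⟨hS p hpS, hd, (differenceProduct_pos H).ne'⟩
        · have := one_sub_one_div_prime_pos (hS p (mem_filter.1 hp).1)
          positivity
        · exact one_le_pow₀
            (one_le_inv_one_sub_one_div_prime (Nat.prime_of_mem_primeFactors hp))

end DifferenceProduct

section LogLogBound

theorem two_pow_card_primeFactors_le {n : ℕ} (hn : n ≠ 0) : 2 ^ #n.primeFactors ≤ n :=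
  calc 2 ^ #n.primeFactors ≤ ∏ p ∈ n.primeFactors, p :=
        pow_card_le_prod _ _ _ fun _ hp => (Nat.prime_of_mem_primeFactors hp).two_le
    _ ≤ n := Nat.le_of_dvd (Nat.pos_of_ne_zero hn) (Nat.prod_primeFactors_dvd n)

theorem prod_inv_one_sub_inv_le_exp_two {s : Finset ℕ} {y : ℕ} (hs : ∀ p ∈ s, p.Prime)
    (hy : 0 < y) (hys : ∀ p ∈ s, y < p) (hcard : #s ≤ y) :
    ∏ p ∈ s, (1 - 1 / (p : ℝ))⁻¹ ≤ Real.exp 2 := by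
  have : (0 : ℝ) < y := Nat.cast_pos.2 hy
  calc ∏ p ∈ s, (1 - 1 / (p : ℝ))⁻¹ ≤ ∏ _p ∈ s, Real.exp (2 * (1 / y)) := by
        refine prod_le_prod (fun p hp => zero_le_one.trans
          (one_le_inv_one_sub_one_div_prime (hs p hp))) fun p hp => ?_
        refine (inv_one_sub_le_exp_two_mul (by positivity) (one_div_le_one_div_of_le two_pos
          (Nat.ofNat_le_cast.2 (hs p hp).two_le))).trans ?_
        have := hys p hp
        gcongr
    _ = Real.exp (2 * (1 / y)) ^ #s := prod_const _
    _ ≤ Real.exp (2 * (1 / y)) ^ y := pow_le_pow_right₀ (Real.one_le_exp (by positivity)) hcard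
    _ = Real.exp 2 := by
        rw [← Real.exp_nat_mul]
        congr 1
        field_simp

theorem exists_prod_primeFactors_inv_one_sub_inv_le :
    ∃ C : ℝ, 0 < C ∧ ∀ n y : ℕ, n ≠ 0 → 2 ≤ y → n ≤ 2 ^ y →
      ∏ p ∈ n.primeFactors, (1 - 1 / (p : ℝ))⁻¹ ≤ C * Real.log y ^ 16 := by
  obtain ⟨C, hC, hMertens⟩ := exists_prod_primesLE_inv_one_sub_inv_le
  refine ⟨C * Real.exp 2, by positivity, fun n y hn hy hny => ?_⟩
  have one_le {p : ℕ} (hp : p ∈ n.primeFactors) : 1 ≤ (1 - 1 / (p : ℝ))⁻¹ :=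
    one_le_inv_one_sub_one_div_prime (Nat.prime_of_mem_primeFactors hp)
  have hsmall : ∏ p ∈ n.primeFactors with p ≤ y, (1 - 1 / (p : ℝ))⁻¹ ≤ C * Real.log y ^ 16 := by
    refine le_trans ?_ (hMertens y hy)
    refine prod_le_prod_of_subset_of_one_le (fun p hp => ?_)
      (fun p hp => zero_le_one.trans (one_le (mem_filter.1 hp).1)) fun p hp _ =>
        one_le_inv_one_sub_one_div_prime (Nat.prime_of_mem_primesLE hp)
    obtain ⟨hp, hpy⟩ := mem_filter.1 hp
    exact Nat.mem_primesLE.2 ⟨hpy, Nat.prime_of_mem_primeFactors hp⟩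
  have hlarge : ∏ p ∈ n.primeFactors with ¬ p ≤ y, (1 - 1 / (p : ℝ))⁻¹ ≤ Real.exp 2 :=
    prod_inv_one_sub_inv_le_exp_two
      (fun p hp => Nat.prime_of_mem_primeFactors (mem_filter.1 hp).1) (by positivity)
      (fun p hp => not_le.1 (mem_filter.1 hp).2)
      ((card_filter_le _ _).trans ((Nat.pow_le_pow_iff_right one_lt_two).1
        ((two_pow_card_primeFactors_le hn).trans hny)))
  calc ∏ p ∈ n.primeFactors, (1 - 1 / (p : ℝ))⁻¹
      = (∏ p ∈ n.primeFactors with p ≤ y, (1 - 1 / (p : ℝ))⁻¹) *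
          ∏ p ∈ n.primeFactors with ¬ p ≤ y, (1 - 1 / (p : ℝ))⁻¹ :=
        (prod_filter_mul_prod_filter_not _ _ _).symm
    _ ≤ C * Real.log y ^ 16 * Real.exp 2 :=
        mul_le_mul hsmall hlarge
          (prod_nonneg fun p hp => zero_le_one.trans (one_le (mem_filter.1 hp).1))
          (by have := Real.log_natCast_nonneg y; positivity)
    _ = C * Real.exp 2 * Real.log y ^ 16 := by ring

theorem exists_log_ceil_mul_le {a : ℝ} (ha : 0 < a) :
    ∃ M : ℝ, 0 < M ∧ ∀ L : ℝ, 2 ≤ L → Real.log ⌈a * L⌉₊ ≤ M * Real.log L := by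
  have hlog₂ : 0 < Real.log 2 := Real.log_pos one_lt_two
  have hlog : 0 < Real.log (a + 1) := Real.log_pos (by linarith)
  refine ⟨Real.log (a + 1) / Real.log 2 + 1, by positivity, fun L hL => ?_⟩
  have hpos : 0 < a * L := by positivity
  calc Real.log ⌈a * L⌉₊ ≤ Real.log ((a + 1) * L) := by
        refine Real.log_le_log (by positivity) ?_
        linarith [Nat.ceil_lt_add_one hpos.le]
    _ = Real.log (a + 1) / Real.log 2 * Real.log 2 + Real.log L := by
        rw [Real.log_mul (by positivity) (by positivity), div_mul_cancel₀ _ hlog₂.ne']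
    _ ≤ Real.log (a + 1) / Real.log 2 * Real.log L + Real.log L := by gcongr
    _ = (Real.log (a + 1) / Real.log 2 + 1) * Real.log L := by ring

theorem two_le_log_three_mul {X : ℝ} (hX : 3 ≤ X) : 2 ≤ Real.log (3 * X) := by
  rw [Real.le_log_iff_exp_le (by positivity), ← one_add_one_eq_two, Real.exp_add]
  nlinarith [Real.exp_one_lt_d9, Real.exp_pos 1]

theorem exists_differenceProduct_le_two_pow (k : ℕ) (K : ℝ) :
    ∃ a : ℝ, 1 ≤ a ∧ ∀ X : ℝ, 3 ≤ X → ∀ H : Finset ℕ, #H ≤ k → (∀ h ∈ H, (h : ℝ) ≤ K * X) →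
      differenceProduct H ≤ 2 ^ ⌈a * Real.log (3 * X)⌉₊ := by
  set c := Real.log (max K 1) + 1
  have hc : 1 ≤ c := le_add_of_nonneg_left (Real.log_nonneg (le_max_right K 1))
  have hlog₂ : 0 < Real.log 2 := Real.log_pos one_lt_two
  refine ⟨max 1 (k ^ 2 * c / Real.log 2), le_max_left _ _, fun X hX H hcard hH => ?_⟩
  set L := Real.log (3 * X)
  set y := ⌈max 1 (k ^ 2 * c / Real.log 2) * L⌉₊
  have hL := two_le_log_three_mul hX
  have hB : 1 ≤ max K 1 * X := by nlinarith [le_max_right K 1]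
  have hlogB : Real.log (max K 1 * X) ≤ c * L := by
    have hX' : Real.log X ≤ L := Real.log_le_log (by positivity) (by linarith)
    rw [Real.log_mul (by positivity) (by positivity)]
    nlinarith
  have hy : (k : ℝ) ^ 2 * (c * L) ≤ y * Real.log 2 := by
    rw [← div_le_iff₀ hlog₂, ← mul_assoc, mul_div_right_comm]
    exact (mul_le_mul_of_nonneg_right (le_max_right _ _) (by linarith)).trans (Nat.le_ceil _)
  have hreal : (differenceProduct H : ℝ) ≤ 2 ^ y :=
    calc (differenceProduct H : ℝ) ≤ (max K 1 * X) ^ #H ^ 2 :=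
          differenceProduct_le_pow hB fun h hh => (hH h hh).trans (by gcongr; exact le_max_left K 1)
      _ ≤ (max K 1 * X) ^ k ^ 2 := pow_le_pow_right₀ hB (Nat.pow_le_pow_left hcard 2)
      _ ≤ 2 ^ y := by
          rw [← Real.log_le_log_iff (by positivity) (by positivity), Real.log_pow, Real.log_pow,
            Nat.cast_pow]
          exact (mul_le_mul_of_nonneg_left hlogB (by positivity)).trans hy
  exact_mod_cast hreal

theorem exists_singularSeries_le (k : ℕ) (K : ℝ) :
    ∃ E : ℝ, 0 < E ∧ ∀ X : ℝ, 3 ≤ X → ∀ H : Finset ℕ, #H ≤ k → (∀ h ∈ H, (h : ℝ) ≤ K * X) →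
      singularSeries H ≤ E * Real.log (Real.log (3 * X)) ^ (16 * k) := by
  obtain ⟨C, hC, hprod⟩ := exists_prod_primeFactors_inv_one_sub_inv_le
  obtain ⟨a, ha, hdiff⟩ := exists_differenceProduct_le_two_pow k K
  obtain ⟨M, hM, hlog⟩ := exists_log_ceil_mul_le (zero_lt_one.trans_le ha)
  refine ⟨(C * M ^ 16) ^ k, by positivity, fun X hX H hcard hH => ?_⟩
  set L := Real.log (3 * X)
  set y := ⌈a * L⌉₊
  have hL : 2 ≤ L := two_le_log_three_mul hX
  have hy : 2 ≤ y := by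
    have : (2 : ℝ) ≤ y := le_trans (by nlinarith) (Nat.le_ceil (a * L))
    exact_mod_cast this
  calc singularSeries H
      ≤ (∏ p ∈ (differenceProduct H).primeFactors, (1 - 1 / (p : ℝ))⁻¹) ^ #H :=
        singularSeries_le_prod_primeFactors H
    _ ≤ (∏ p ∈ (differenceProduct H).primeFactors, (1 - 1 / (p : ℝ))⁻¹) ^ k :=
        pow_le_pow_right₀ (one_le_prod fun p hp =>
          one_le_inv_one_sub_one_div_prime (Nat.prime_of_mem_primeFactors hp)) hcard
    _ ≤ (C * Real.log y ^ 16) ^ k := by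
        refine pow_le_pow_left₀ (prod_nonneg fun p hp => zero_le_one.trans
          (one_le_inv_one_sub_one_div_prime (Nat.prime_of_mem_primeFactors hp))) ?_ k
        exact hprod _ y (differenceProduct_pos H).ne' hy (hdiff X hX H hcard hH)
    _ ≤ (C * (M * Real.log L) ^ 16) ^ k := by
        have := Real.log_natCast_nonneg y
        gcongr
        exact hlog L hL
    _ = (C * M ^ 16) ^ k * Real.log L ^ (16 * k) := by rw [pow_mul, ← mul_pow]; ring

end LogLogBound

section SingularSeriesSieve

variable {H : Finset ℕ}

theorem dvd_shiftProd_of_le_residueCount {p : ℕ} (hp : p.Prime) (hH : p ≤ residueCount H p)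
    (n : ℕ) : p ∣ shiftProd H n := by
  have hall : {r ∈ range p | p ∣ shiftProd H r} = range p :=
    eq_of_subset_of_card_le (filter_subset _ _)
      ((card_range p).trans_le (hH.trans (rootCount_shiftProd H hp).ge))
  exact ((congruencePreserving_shiftProd H).dvd_iff (Nat.mod_modEq n p)).1
    (filter_eq_self.1 hall (n % p) (mem_range.2 (Nat.mod_lt n hp.pos)))

theorem filter_forall_prime_add_eq_empty {s : Finset ℕ} {p : ℕ} (hp : p.Prime)
    (hps : ∀ n ∈ s, p < n) (hH : p ≤ residueCount H p) :
    {n ∈ s | ∀ h ∈ H, (n + h).Prime} = ∅ :=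
  filter_eq_empty_iff.2 fun n hn hprime => Nat.not_coprime_of_dvd_of_dvd hp.one_lt
    (hp.dvd_primorial_iff.2 le_rfl) (dvd_shiftProd_of_le_residueCount hp hH n)
    (coprime_primorial_shiftProd (hps n hn) hprime)

theorem prod_one_sub_residueCount_div_eq (H : Finset ℕ) (z : ℕ) :
    ∏ p ∈ z.primesLE, (1 - (residueCount H p : ℝ) / p) =
      (∏ p ∈ z.primesLE, singularFactor H p) * (∏ p ∈ z.primesLE, (1 - 1 / (p : ℝ))) ^ #H := by
  rw [← prod_pow, ← prod_mul_distrib]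
  refine prod_congr rfl fun p hp => ?_
  have := pow_pos (one_sub_one_div_prime_pos (Nat.prime_of_mem_primesLE hp)) #H
  rw [singularFactor, inv_mul_cancel_right₀ this.ne']

theorem prod_one_sub_residueCount_div_le {z : ℕ} (hz₂ : 2 ≤ z)
    (hz : 2 ^ (#H + 2) * #H ^ 2 ≤ z) :
    ∏ p ∈ z.primesLE, (1 - (residueCount H p : ℝ) / p) ≤
      2 * singularSeries H * (Real.log z)⁻¹ ^ #H := by
  have hsingular : ∏ p ∈ z.primesLE, singularFactor H p ≤ 2 * singularSeries H := by
    linarith [half_prod_singularFactor_le_singularSeries hz]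
  have hnonneg : 0 ≤ ∏ p ∈ z.primesLE, (1 - 1 / (p : ℝ)) :=
    prod_nonneg fun p hp => (one_sub_one_div_prime_pos (Nat.prime_of_mem_primesLE hp)).le
  rw [prod_one_sub_residueCount_div_eq]
  exact mul_le_mul hsingular (pow_le_pow_left₀ hnonneg (prod_primesLE_one_sub_inv_le hz₂) _)
    (pow_nonneg hnonneg _) (mul_nonneg zero_le_two (singularSeries_nonneg H))

theorem card_prime_tuples_le_singularSeries (hH : H.Nonempty) {a N z : ℕ}
    (hz : 2 ^ (#H + 2) * #H ^ 2 ≤ z) (hza : z < a) :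
    (#{n ∈ Ico a (a + N) | ∀ h ∈ H, (n + h).Prime} : ℝ) ≤
      4 * (N + (z : ℝ) ^ (12 * (6 * #H + 1))) * singularSeries H * (Real.log z)⁻¹ ^ #H := by
  have hz₂ : 2 ≤ z :=
    calc 2 = 2 ^ 1 * 1 ^ 2 := by norm_num
      _ ≤ 2 ^ (#H + 2) * #H ^ 2 := by
          gcongr
          exacts [one_le_two, by omega, hH.card_pos]
      _ ≤ z := hz
  by_cases hadm : ∀ p ∈ z.primesLE, residueCount H p < p
  · calc (#{n ∈ Ico a (a + N) | ∀ h ∈ H, (n + h).Prime} : ℝ)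
        ≤ 2 * (N + ((z ^ (6 * #H + 1) : ℕ) : ℝ) ^ 12) *
            ∏ p ∈ z.primesLE, (1 - (residueCount H p : ℝ) / p) :=
          card_prime_tuples_le hH hz₂ hza le_rfl hadm
      _ ≤ 2 * (N + ((z ^ (6 * #H + 1) : ℕ) : ℝ) ^ 12) *
            (2 * singularSeries H * (Real.log z)⁻¹ ^ #H) := by
          gcongr
          exact prod_one_sub_residueCount_div_le hz₂ hz
      _ = _ := by push_cast; ring
  · push Not at hadm
    obtain ⟨p, hp, hle⟩ := hadm
    obtain ⟨hpz, hpp⟩ := Nat.mem_primesLE.1 hp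
    rw [filter_forall_prime_add_eq_empty hpp
      (fun n hn => (hpz.trans_lt hza).trans_le (mem_Ico.1 hn).1) hle, card_empty, Nat.cast_zero]
    have := singularSeries_nonneg H
    have := Real.log_natCast_nonneg z
    positivity

theorem exists_nat_pow_le_and_log_le {n W : ℕ} (hn : n ≠ 0) (hW : 2 ≤ W) {X : ℝ}
    (hX : (W : ℝ) ^ n ≤ X) :
    ∃ z : ℕ, W ≤ z ∧ (z : ℝ) ^ n ≤ X ∧ Real.log X ≤ 2 * n * Real.log z := by
  have hX₀ : 0 ≤ X := le_trans (by positivity) hX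
  set r : ℝ := X ^ ((n : ℝ)⁻¹)
  have hr₀ : 0 ≤ r := Real.rpow_nonneg hX₀ _
  have hrX : r ^ n = X := Real.rpow_inv_natCast_pow hX₀ hn
  have hWr : (W : ℝ) ≤ r := (pow_le_pow_iff_left₀ W.cast_nonneg hr₀ hn).1 (hrX ▸ hX)
  have hWz : W ≤ ⌊r⌋₊ := Nat.le_floor hWr
  refine ⟨⌊r⌋₊, hWz, hrX ▸ pow_le_pow_left₀ (Nat.cast_nonneg _) (Nat.floor_le hr₀) n, ?_⟩
  have hz : (2 : ℝ) ≤ ⌊r⌋₊ := by exact_mod_cast hW.trans hWz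
  have hr : 0 < r := by linarith [Nat.floor_le hr₀]
  have hrz : r ≤ (⌊r⌋₊ : ℝ) ^ 2 := by nlinarith [Nat.lt_floor_add_one r]
  calc Real.log X = n * Real.log r := by rw [← hrX, Real.log_pow]
    _ ≤ n * Real.log ((⌊r⌋₊ : ℝ) ^ 2) := by gcongr
    _ = 2 * n * Real.log ⌊r⌋₊ := by rw [Real.log_pow]; push_cast; ring

theorem exists_card_prime_tuples_dyadic_le {k : ℕ} (hk : k ≠ 0) :
    ∃ C : ℝ, 0 < C ∧ ∀ᶠ X : ℝ in Filter.atTop, ∀ H : Finset ℕ, #H = k →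
      (#{n ∈ Icc ⌈X⌉₊ ⌊2 * X⌋₊ | ∀ h ∈ H, (n + h).Prime} : ℝ) ≤
        C * X * singularSeries H / Real.log X ^ k := by
  set n : ℕ := 12 * (6 * k + 1)
  set W : ℕ := 2 ^ (k + 2) * k ^ 2
  have hW : 2 ≤ W :=
    (le_self_pow₀ one_le_two (by omega)).trans (Nat.le_mul_of_pos_right _ (by positivity))
  refine ⟨12 * (2 * n) ^ k, by positivity, ?_⟩
  filter_upwards [Filter.eventually_ge_atTop ((W : ℝ) ^ n), Filter.eventually_gt_atTop 1] with
    X hX hX₁ H hH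
  obtain ⟨z, hWz, hzX, hlog⟩ := exists_nat_pow_le_and_log_le (by omega) hW hX
  have hz : (2 : ℝ) ≤ z := by exact_mod_cast hW.trans hWz
  have hza : z < ⌈X⌉₊ :=
    Nat.lt_ceil.2 ((lt_self_pow₀ (by linarith) (by omega)).trans_le hzX)
  have hlogX : 0 < Real.log X := Real.log_pos hX₁
  have hlogz : 0 < Real.log z := Real.log_pos (by linarith)
  have hinv : (Real.log z)⁻¹ ≤ 2 * n / Real.log X := by
    rw [inv_eq_one_div, div_le_div_iff₀ hlogz hlogX]
    linarith
  have hS := singularSeries_nonneg H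
  calc (#{n ∈ Icc ⌈X⌉₊ ⌊2 * X⌋₊ | ∀ h ∈ H, (n + h).Prime} : ℝ)
      ≤ #{n ∈ Ico ⌈X⌉₊ (⌈X⌉₊ + ⌊2 * X⌋₊) | ∀ h ∈ H, (n + h).Prime} := by
        refine Nat.cast_le.2 (card_le_card (filter_subset_filter _ fun m hm => ?_))
        simp only [mem_Icc, mem_Ico] at hm ⊢
        omega
    _ ≤ 4 * (⌊2 * X⌋₊ + (z : ℝ) ^ n) * singularSeries H * (Real.log z)⁻¹ ^ k := by
        have := card_prime_tuples_le_singularSeries (card_pos.1 (by omega : 0 < #H))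
          (N := ⌊2 * X⌋₊) (by rwa [hH]) hza
        rwa [hH] at this
    _ ≤ 4 * (2 * X + X) * singularSeries H * (2 * n / Real.log X) ^ k := by
        gcongr
        exact Nat.floor_le (by linarith)
    _ = 12 * (2 * n) ^ k * X * singularSeries H / Real.log X ^ k := by rw [div_pow]; ring

end SingularSeriesSieve

section GapVector

theorem nextPrime_prime (p : ℕ) : (nextPrime p).Prime :=
  (Nat.find_spec (Nat.exists_infinite_primes (p + 1))).2

theorem lt_nextPrime (p : ℕ) : p < nextPrime p :=
  (Nat.find_spec (Nat.exists_infinite_primes (p + 1))).1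

theorem nextPrime_le_two_mul {p : ℕ} (hp : p ≠ 0) : nextPrime p ≤ 2 * p := by
  obtain ⟨q, hq, hpq, hle⟩ := Nat.exists_prime_lt_and_le_two_mul p hp
  exact (Nat.find_min' _ ⟨hpq, hq⟩).trans hle

variable {p : ℕ}

theorem iterate_nextPrime_prime (hp : p.Prime) (j : ℕ) : (nextPrime^[j] p).Prime :=
  Function.Iterate.rec Nat.Prime hp (fun q _ => nextPrime_prime q) j

theorem iterate_nextPrime_le (hp : p.Prime) (j : ℕ) : nextPrime^[j] p ≤ 2 ^ j * p := by
  induction j with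
  | zero => simp
  | succ j ih =>
    rw [Function.iterate_succ_apply', pow_succ', mul_assoc]
    exact (nextPrime_le_two_mul (iterate_nextPrime_prime hp j).ne_zero).trans
      (Nat.mul_le_mul_left 2 ih)

variable {t : ℕ} {g : Fin t → ℕ}

theorem offset_zero (g : Fin t → ℕ) : offset g 0 = 0 := by simp [offset]

theorem offset_succ (g : Fin t → ℕ) (i : Fin t) :
    offset g i.succ = offset g i.castSucc + g i := by
  have hinsert : ({j | j.val < i.succ.val} : Finset (Fin t)) =
      insert i ({j | j.val < i.castSucc.val} : Finset (Fin t)) := by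
    ext j
    simp only [mem_filter_univ, mem_insert, Fin.ext_iff, Fin.val_succ, Fin.val_castSucc]
    omega
  rw [offset, hinsert, sum_insert (by simp), offset, add_comm]

theorem card_offsetSet_le (g : Fin t → ℕ) : #(offsetSet g) ≤ t + 1 :=
  card_image_le.trans_eq (by simp)

theorem card_offsetSet (hg : ∀ i, 0 < g i) : #(offsetSet g) = t + 1 := by
  have hmono : StrictMono (offset g) := Fin.strictMono_iff_lt_succ.2 fun i =>
    (offset_succ g i).symm ▸ Nat.lt_add_of_pos_right (hg i)
  rw [offsetSet, card_image_of_injective _ hmono.injective, card_univ, Fintype.card_fin]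

theorem le_offset_last_of_mem {h : ℕ} (hh : h ∈ offsetSet g) : h ≤ offset g (Fin.last t) := by
  obtain ⟨k, -, rfl⟩ := mem_image.1 hh
  exact sum_le_sum_of_subset fun i _ => mem_filter.2 ⟨mem_univ i, i.isLt⟩

theorem gapVector_pos (t p : ℕ) (i : Fin t) : 0 < gapVector t p i :=
  Nat.sub_pos_of_lt (lt_nextPrime _)

theorem iterate_nextPrime_eq_add_offset (t p : ℕ) (k : Fin (t + 1)) :
    nextPrime^[k.val] p = p + offset (gapVector t p) k := by
  induction k using Fin.induction with
  | zero => simp [offset_zero]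
  | succ i ih =>
    rw [Fin.val_castSucc] at ih
    rw [offset_succ, ← add_assoc, ← ih, Fin.val_succ, Function.iterate_succ_apply']
    exact (Nat.add_sub_cancel' (lt_nextPrime _).le).symm

theorem prime_add_of_mem_offsetSet_gapVector (hp : p.Prime) {h : ℕ}
    (hh : h ∈ offsetSet (gapVector t p)) : (p + h).Prime := by
  obtain ⟨k, -, rfl⟩ := mem_image.1 hh
  exact iterate_nextPrime_eq_add_offset t p k ▸ iterate_nextPrime_prime hp k

theorem offset_gapVector_last_le (hp : p.Prime) (t : ℕ) :
    offset (gapVector t p) (Fin.last t) ≤ 2 ^ t * p :=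
  calc offset (gapVector t p) (Fin.last t) ≤ nextPrime^[t] p :=
        (Nat.le_add_left _ p).trans_eq (iterate_nextPrime_eq_add_offset t p (Fin.last t)).symm
    _ ≤ 2 ^ t * p := iterate_nextPrime_le hp t

end GapVector

section GapLaw

variable {t : ℕ} {X : ℝ}

/-- The set `dyadicPrimes X` as a finset (for `0 ≤ X`), in which the uniform law is a ratio of
cardinalities. -/
noncomputable def dyadicPrimesFinset (X : ℝ) : Finset ℕ := {p ∈ Icc ⌈X⌉₊ ⌊2 * X⌋₊ | p.Prime}

theorem coe_dyadicPrimesFinset (hX : 0 ≤ X) :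
    (dyadicPrimesFinset X : Set ℕ) = dyadicPrimes X := by
  ext p
  simp only [dyadicPrimesFinset, coe_filter, mem_Icc, Set.mem_ofPred_eq, dyadicPrimes,
    Nat.ceil_le, Nat.le_floor_iff (by positivity : 0 ≤ 2 * X)]
  tauto

theorem gapLaw_real_singleton (t : ℕ) (hX : 0 ≤ X) (g : Fin t → ℕ) :
    (gapLaw t X).real {g} =
      #{p ∈ dyadicPrimesFinset X | gapVector t p = g} / #(dyadicPrimesFinset X) := by
  have hpreimage : (dyadicPrimesFinset X : Set ℕ) ∩ gapVector t ⁻¹' {g} =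
      ({p ∈ dyadicPrimesFinset X | gapVector t p = g} : Finset ℕ) := by
    ext p
    simp
  rw [MeasureTheory.measureReal_def, gapLaw,
    MeasureTheory.Measure.map_apply Measurable.of_discrete (measurableSet_singleton g),
    ← coe_dyadicPrimesFinset hX, ← ProbabilityTheory.uniformOn_inter_self (finite_toSet _),
    hpreimage, ProbabilityTheory.uniformOn_apply_finset, inter_eq_right.2 (filter_subset _ _),
    ENNReal.toReal_div, ENNReal.toReal_natCast, ENNReal.toReal_natCast]

theorem exists_gapVector_eq_of_gapLaw_real_singleton_ne_zero (hX : 0 ≤ X) {g : Fin t → ℕ}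
    (hg : (gapLaw t X).real {g} ≠ 0) : ∃ p ∈ dyadicPrimes X, gapVector t p = g := by
  rw [gapLaw_real_singleton t hX] at hg
  contrapose! hg
  rw [filter_eq_empty_iff.2 fun p hp => hg p (coe_dyadicPrimesFinset hX ▸ mem_coe.2 hp),
    card_empty, Nat.cast_zero, zero_div]

theorem eventually_le_card_dyadicPrimesFinset :
    ∀ᶠ X : ℝ in Filter.atTop, X / (24 * Real.log X) ≤ #(dyadicPrimesFinset X) := by
  filter_upwards [tendsto_nat_floor_atTop.eventually eventually_le_card_primesLE_two_mul_filter,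
    Filter.eventually_ge_atTop 2] with X hcard hX
  set n := ⌊X⌋₊
  have hnX : (n : ℝ) ≤ X := Nat.floor_le (by linarith)
  have hXn : X < n + 1 := Nat.lt_floor_add_one X
  have : 0 < Real.log X := Real.log_pos (by linarith)
  have hlogn : 0 < Real.log (2 * n) := Real.log_pos (by linarith)
  have hlog : Real.log (2 * n) ≤ 2 * Real.log X :=
    calc Real.log (2 * n) ≤ Real.log (X ^ 2) := Real.log_le_log (by linarith) (by nlinarith)
      _ = 2 * Real.log X := by rw [Real.log_pow, Nat.cast_ofNat]
  calc X / (24 * Real.log X) = 1 / 6 * (X / 2) / (2 * Real.log X) := by ring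
    _ ≤ 1 / 6 * n / Real.log (2 * n) := by
        gcongr
        linarith
    _ ≤ #{p ∈ (2 * n).primesLE | n < p} := hcard
    _ ≤ #(dyadicPrimesFinset X) := by
        refine Nat.cast_le.2 (card_le_card fun p hp => ?_)
        obtain ⟨hp, hnp⟩ := mem_filter.1 hp
        obtain ⟨hpn, hpp⟩ := Nat.mem_primesLE.1 hp
        have hnp' : (n : ℝ) + 1 ≤ p := by exact_mod_cast hnp
        have hpn' : (p : ℝ) ≤ 2 * n := by exact_mod_cast hpn
        exact mem_filter.2 ⟨mem_Icc.2 ⟨Nat.ceil_le.2 (by linarith),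
          Nat.le_floor (by linarith)⟩, hpp⟩

theorem exists_gapLaw_le_singularSeries (t : ℕ) :
    ∃ C : ℝ, 0 < C ∧ ∀ᶠ X : ℝ in Filter.atTop, ∀ g : Fin t → ℕ,
      (gapLaw t X).real {g} ≤ C * singularSeries (offsetSet g) / Real.log X ^ t := by
  obtain ⟨C, hC, htuples⟩ := exists_card_prime_tuples_dyadic_le t.succ_ne_zero
  refine ⟨24 * C, by positivity, ?_⟩
  filter_upwards [htuples, eventually_le_card_dyadicPrimesFinset,
    Filter.eventually_gt_atTop 1] with X htuples hprimes hX g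
  have hlogX : 0 < Real.log X := Real.log_pos hX
  have hS := singularSeries_nonneg (offsetSet g)
  by_cases hg : (gapLaw t X).real {g} = 0
  · rw [hg]
    positivity
  obtain ⟨p, -, rfl⟩ := exists_gapVector_eq_of_gapLaw_real_singleton_ne_zero (by linarith) hg
  set g := gapVector t p
  rw [gapLaw_real_singleton t (by linarith), div_le_iff₀ (lt_of_lt_of_le (by positivity) hprimes)]
  calc (#{q ∈ dyadicPrimesFinset X | gapVector t q = g} : ℝ)
      ≤ #{n ∈ Icc ⌈X⌉₊ ⌊2 * X⌋₊ | ∀ h ∈ offsetSet g, (n + h).Prime} := by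
        refine Nat.cast_le.2 (card_le_card fun q hq => ?_)
        obtain ⟨hq, hqg⟩ := mem_filter.1 hq
        obtain ⟨hqX, hqp⟩ := mem_filter.1 hq
        exact mem_filter.2 ⟨hqX, fun h hh => prime_add_of_mem_offsetSet_gapVector hqp (hqg ▸ hh)⟩
    _ ≤ C * X * singularSeries (offsetSet g) / Real.log X ^ (t + 1) :=
        htuples _ (card_offsetSet (gapVector_pos t p))
    _ = 24 * C * singularSeries (offsetSet g) / Real.log X ^ t * (X / (24 * Real.log X)) := by
        rw [pow_succ]
        field_simp
    _ ≤ 24 * C * singularSeries (offsetSet g) / Real.log X ^ t * #(dyadicPrimesFinset X) := by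
        gcongr

theorem gapLaw_real_singleton_eq_zero_of_lt_offset (hX : 0 ≤ X) {g : Fin t → ℕ}
    (hg : 2 ^ (t + 1) * X < offset g (Fin.last t)) : (gapLaw t X).real {g} = 0 := by
  contrapose! hg
  obtain ⟨p, ⟨hp, -, hpX⟩, rfl⟩ := exists_gapVector_eq_of_gapLaw_real_singleton_ne_zero hX hg
  calc (offset (gapVector t p) (Fin.last t) : ℝ) ≤ 2 ^ t * p := by
        exact_mod_cast offset_gapVector_last_le hp t
    _ ≤ 2 ^ t * (2 * X) := by gcongr
    _ = 2 ^ (t + 1) * X := by ring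

theorem exists_mul_singularSeries_offsetSet_div_log_pow_le (t : ℕ) {C : ℝ} (hC : 0 < C) (K : ℝ) :
    ∃ D : ℝ, 0 < D ∧ ∀ X : ℝ, 3 ≤ X → ∀ g : Fin t → ℕ, (offset g (Fin.last t) : ℝ) ≤ K * X →
      C * singularSeries (offsetSet g) / Real.log X ^ t ≤
        D * Real.log (Real.log (3 * X)) ^ (16 * (t + 1)) / Real.log X ^ t := by
  obtain ⟨E, hE, hsingular⟩ := exists_singularSeries_le (t + 1) K
  refine ⟨C * E, by positivity, fun X hX g hg => ?_⟩
  have : 0 < Real.log X := Real.log_pos (by linarith)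
  rw [mul_assoc C]
  gcongr
  exact hsingular X hX _ (card_offsetSet_le g) fun h hh =>
    (Nat.cast_le.2 (le_offset_last_of_mem hh)).trans hg

end GapLaw

end PrimeGaps

theorem mainTheorem6 (t : ℕ) (ht : 1 ≤ t) :
    ∃ (C X₀ : ℝ) (A : ℕ), 0 < C ∧
      (∀ X : ℝ, X₀ ≤ X → ∀ g : Fin t → ℕ,
        (PrimeGaps.gapLaw t X).real {g} ≤
          C * PrimeGaps.singularSeries (PrimeGaps.offsetSet g) / Real.log X ^ t) ∧
      (∀ K : ℝ, 0 < K → ∃ D : ℝ, 0 < D ∧ ∀ X : ℝ, X₀ ≤ X → ∀ g : Fin t → ℕ,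
        (PrimeGaps.offset g (Fin.last t) : ℝ) ≤ K * X →
          C * PrimeGaps.singularSeries (PrimeGaps.offsetSet g) / Real.log X ^ t ≤
            D * Real.log (Real.log (3 * X)) ^ A / Real.log X ^ t) ∧
      (∃ D : ℝ, 0 < D ∧ ∀ X : ℝ, X₀ ≤ X → ∀ g : Fin t → ℕ,
        (PrimeGaps.gapLaw t X).real {g} ≤
          D * Real.log (Real.log (3 * X)) ^ A / Real.log X ^ t) := by
  obtain ⟨C, hC, hlaw⟩ := PrimeGaps.exists_gapLaw_le_singularSeries t
  obtain ⟨X₀, hX₀⟩ := Filter.eventually_atTop.1 (hlaw.and (Filter.eventually_ge_atTop 3))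
  have hsingular := PrimeGaps.exists_mul_singularSeries_offsetSet_div_log_pow_le t hC
  refine ⟨C, X₀, 16 * (t + 1), hC, fun X hX => (hX₀ X hX).1, fun K _ => ?_, ?_⟩
  · obtain ⟨D, hD, hbound⟩ := hsingular K
    exact ⟨D, hD, fun X hX => hbound X (hX₀ X hX).2⟩
  · obtain ⟨D, hD, hbound⟩ := hsingular (2 ^ (t + 1))
    refine ⟨D, hD, fun X hX g => ?_⟩
    have h₃ : 3 ≤ X := (hX₀ X hX).2
    rcases le_or_gt (PrimeGaps.offset g (Fin.last t) : ℝ) (2 ^ (t + 1) * X) with hg | hg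
    · exact ((hX₀ X hX).1 g).trans (hbound X h₃ g hg)
    · rw [PrimeGaps.gapLaw_real_singleton_eq_zero_of_lt_offset (by linarith) hg]
      have := Real.log_pos (by linarith : 1 < X)
      have := Real.log_nonneg (by linarith [PrimeGaps.two_le_log_three_mul h₃] :
        1 ≤ Real.log (3 * X))
      positivity
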